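/- Let $p\ge 3$ and $n\ge 1$ be integers and let $f:[0,\infty)\to[0,\infty)$ be a measurable function such that $(x,z)\mapsto f(\|x\|^2+\|z\|^2)$ is a probability density on $\mathbb R^p\times\mathbb R^n$. Let $(X,Z)\in\mathbb R^p\times\mathbb R^n$ have the density $$\eta^{(p+n)/2} f\bigl(\eta\{\|x-\theta\|^2+\|z\|^2\}\bigr)$$ with $\theta\in\mathbb R^p$ and $\eta=\sigma^{-2}>0$ both unknown. Consider estimation of $\theta$ under the loss $\eta\|d-\theta\|^2$. An estimator $\delta(X,Z)$ is minimax if its maximal risk $\sup_{\theta,\eta}E_{\theta,\eta}[\eta\|\delta(X,Z)-\theta\|^2]\in[0,\infty]$ does not exceed that of any other (measurable) estimator. For real $a,e$ take the improper prior density $$\pi_{a,e}(\theta,\eta)=\|\theta\|^{-2(p/2+a+1)}\,\eta^{-a-1+e}$$ with respect to $d\theta\,d\eta$ on $\mathbb R^p\times(0,\infty)$. The generalized Bayes estimator with respect to $\pi_{a,e}$ is the minimizer of the posterior expected loss, namely $$\delta_{a,e}(x,z)=\frac{\int_{\mathbb R^p}\int_0^\infty \theta\,\eta\cdot\eta^{(p+n)/2}f(\eta\{\|x-\theta\|^2+\|z\|^2\})\,\pi_{a,e}(\theta,\eta)\,d\eta\,d\theta}{\int_{\mathbb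 R^p}\int_0^\infty \eta\cdot\eta^{(p+n)/2}f(\eta\{\|x-\theta\|^2+\|z\|^2\})\,\pi_{a,e}(\theta,\eta)\,d\eta\,d\theta}.$$ Put $c(p,n)=2(p-2)/(n+2)$, $$u_*(p,n,e)=\frac{c(p,n)(n/2+e)-p/2-1}{1+c(p,n)},$$ $$\begin{aligned}g(a)={}&(2p+2n+4e+4)a^2+\{2p^2+2pn+12p+7n+4(p+3)e+10\}a\\&+4p^2+\tfrac72pn+6(p+2)e+7n+13p+10,\end{aligned}$$ and consider the moment condition $$\int_0^\infty \eta^{(n+p)/2-a+e}f(\eta)\,d\eta<\infty.\tag{M}$$ (i) Suppose $-p/2-n/2-1<e\le -n/4-3/2$ and $-p/2-1<a\le u_*(p,n,e)$. Then for every $f$ as above that satisfies (M), $\delta_{a,e}(x,z)$ is, for all $x$ and all $z\ne0$, the unique minimizer of the posterior expected loss, with finite minimum, and $\delta_{a,e}$ is minimax. (ii) Suppose $e>-n/4-3/2$ and $n\ge 2$. Then $g$ has exactly two real zeros, the larger of which, $a_*$, lies in $(-2,-1)$; and if $-p/2-1<a\le a_*$, then for every $f$ as above that satisfies (M), $\delta_{a,e}(x,z)$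 is, for all $x$ and all $z\ne0$, the unique minimizer of the posterior expected loss, with finite minimum, and $\delta_{a,e}$ is minimax. -/

import Mathlib

open MeasureTheory Set
open scoped ENNReal

/-- `d`-dimensional Euclidean space. -/
abbrev Euc (d : ℕ) : Type := EuclideanSpace ℝ (Fin d)

namespace SphericalModel

variable {p n : ℕ}

/-- `f : [0, ∞) → [0, ∞)` (values at negative reals are irrelevant) is such that
`(x, z) ↦ f (‖x‖² + ‖z‖²)` is a probability density on `ℝ^p × ℝ^n`. -/
structure IsErrorDensity (p n : ℕ) (f : ℝ → ℝ) : Prop where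
  measurable : Measurable f
  nonneg : ∀ t, 0 ≤ t → 0 ≤ f t
  lintegral_eq_one :
    ∫⁻ y : Euc p × Euc n, ENNReal.ofReal (f (‖y.1‖ ^ 2 + ‖y.2‖ ^ 2)) = 1

/-- The density at `y = (x, z)` of the observation `(X, Z)` with location `θ` and precision
`η = σ⁻²`, that is, `σ^{-(p+n)} f ((‖x - θ‖² + ‖z‖²) / σ²)`. -/
noncomputable def density (f : ℝ → ℝ) (θ : Euc p) (η : ℝ) (y : Euc p × Euc n) : ℝ :=
  η ^ (((p : ℝ) + n) / 2) * f (η * (‖y.1 - θ‖ ^ 2 + ‖y.2‖ ^ 2))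

/-- The scale-invariant quadratic loss `‖d - θ‖² / σ² = η ‖d - θ‖²`. -/
noncomputable def loss (d θ : Euc p) (η : ℝ) : ℝ := η * ‖d - θ‖ ^ 2

/-- The risk `E[loss (δ (X, Z), θ, η)]`, as an extended nonnegative real. -/
noncomputable def risk (f : ℝ → ℝ) (δ : Euc p × Euc n → Euc p) (θ : Euc p) (η : ℝ) : ℝ≥0∞ :=
  ∫⁻ y, ENNReal.ofReal (loss (δ y) θ η * density f θ η y)

/-- The supremum of the risk over all locations `θ` and all scales (`η > 0`). -/
noncomputable def maxRisk (f : ℝ → ℝ) (δ : Euc p × Euc n → Euc p) : ℝ≥0∞ :=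
  ⨆ (θ : Euc p) (η : ℝ) (_ : 0 < η), risk f δ θ η

/-- `δ` is a minimax estimator of `θ`: its maximal risk is the least among all estimators. -/
def IsMinimax (f : ℝ → ℝ) (δ : Euc p × Euc n → Euc p) : Prop :=
  Measurable δ ∧
    ∀ δ' : Euc p × Euc n → Euc p, Measurable δ' → maxRisk f δ ≤ maxRisk f δ'

/-- The (unnormalized) posterior density of `(θ, η)` given `y`, for the improper prior density
`π` with respect to `dθ dη`. -/
noncomputable def posterior (f : ℝ → ℝ) (π : Euc p → ℝ → ℝ) (y : Euc p × Euc n)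
    (θ : Euc p) (η : ℝ) : ℝ :=
  density f θ η y * π θ η

/-- The (unnormalized) posterior expected loss of the decision `d` given `y`. -/
noncomputable def posteriorLoss (f : ℝ → ℝ) (π : Euc p → ℝ → ℝ) (y : Euc p × Euc n)
    (d : Euc p) : ℝ≥0∞ :=
  ∫⁻ θ : Euc p, ∫⁻ η in Ioi (0 : ℝ), ENNReal.ofReal (loss d θ η * posterior f π y θ η)

/-- The estimator `E(η θ | y) / E(η | y)`, expectations under the posterior. -/
noncomputable def genBayes (f : ℝ → ℝ) (π : Euc p → ℝ → ℝ) (y : Euc p × Euc n) : Euc p :=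
  (∫ q : Euc p × ℝ, q.2 * posterior f π y q.1 q.2
      ∂((volume : Measure (Euc p)).prod (volume.restrict (Ioi (0 : ℝ)))))⁻¹ •
    ∫ q : Euc p × ℝ, (q.2 * posterior f π y q.1 q.2) • q.1
      ∂((volume : Measure (Euc p)).prod (volume.restrict (Ioi (0 : ℝ))))

/-- `δ` is the generalized Bayes estimator for the prior density `π`: for all data `(x, z)` with
`z ≠ 0` (hence almost surely) `δ (x, z)` is the unique minimizer of the posterior expected loss,
which is finite there. -/
def IsGeneralizedBayes (f : ℝ → ℝ) (π : Euc p → ℝ → ℝ) (δ : Euc p × Euc n → Euc p) : Prop :=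
  ∀ (x : Euc p) (z : Euc n), z ≠ 0 → ∀ d : Euc p, d ≠ δ (x, z) →
    posteriorLoss f π (x, z) (δ (x, z)) < posteriorLoss f π (x, z) d

/-- The improper prior density `‖θ‖^{-2(p/2+a+1)} η^{-a-1+e}`. -/
noncomputable def prior (a e : ℝ) (θ : Euc p) (η : ℝ) : ℝ :=
  ‖θ‖ ^ (-2 * ((p : ℝ) / 2 + a + 1)) * η ^ (-a - 1 + e)

/-- The moment condition `∫₀^∞ η^{(n+p)/2-a+e} f(η) dη < ∞`. -/
def MomentCondition (p n : ℕ) (a e : ℝ) (f : ℝ → ℝ) : Prop :=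
  IntegrableOn (fun t : ℝ => t ^ (((n : ℝ) + p) / 2 - a + e) * f t) (Ioi 0)

/-- `c(p, n) = 2(p-2)/(n+2)`. -/
noncomputable def cConst (p n : ℕ) : ℝ := 2 * ((p : ℝ) - 2) / ((n : ℝ) + 2)

/-- The upper bound `u_*(p, n, e) = (c(p,n)(n/2+e) - p/2 - 1) / (1 + c(p,n))`. -/
noncomputable def uStar (p n : ℕ) (e : ℝ) : ℝ :=
  (cConst p n * ((n : ℝ) / 2 + e) - (p : ℝ) / 2 - 1) / (1 + cConst p n)

/-- The quadratic `g`. -/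
noncomputable def g (p n : ℕ) (e a : ℝ) : ℝ :=
  (2 * p + 2 * n + 4 * e + 4) * a ^ 2
    + a * (2 * (p : ℝ) ^ 2 + 2 * p * n + 12 * p + 7 * n + 4 * (p + 3) * e + 10)
    + (4 * (p : ℝ) ^ 2 + 7 / 2 * p * n + 6 * (p + 2) * e + 7 * n + 13 * p + 10)

end SphericalModel

/-!
Integrating out `η` turns the posterior loss of `d` into a multiple of
`∫ ‖d - θ‖² ‖θ‖^(-2k) (‖x - θ‖² + ‖z‖²)^(-m) dθ`, in which `f` survives only as a moment. Feynman's
parametrization writes this kernel as a beta mixture of multivariate Student kernels centred at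
`(1 - t) x`, so the generalized Bayes estimator is `(1 - r(‖x‖² / ‖z‖²)) x`, where `r` is a ratio
of hypergeometric integrals.

Stein's identity, applied in `x` and in `z`, writes the difference of the risks of this estimator
and of `x` as one integral, whose integrand is nonpositive as soon as `r` satisfies a quadratic
differential inequality. Integration by parts bounds `r` and `r'`. The bounds suffice for
`a ≤ u_*` when `a ≤ -2`, and for `g(a) ≤ 0` when `-2 ≤ a < -1`. Finally `x` has constant risk and
is itself minimax: over large balls of `θ`, the average risk of any estimator approaches at least
that constant.
-/

namespace SphericalModel

open Filter Topology Module

section BetaIntegral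

/-- The unnormalized density `t^(k-1) (1-t)^b` of the beta distribution with parameters `k` and
`b + 1`. -/
noncomputable def betaWeight (k b t : ℝ) : ℝ := t ^ (k - 1) * (1 - t) ^ b

/-- Euler's integral for the hypergeometric function `₂F₁(N, k; k + b + 1; -w)`, without its
normalizing beta factor. -/
noncomputable def betaInt (k b N w : ℝ) : ℝ :=
  ∫ t in Ioo (0 : ℝ) 1, betaWeight k b t * (1 + w * t) ^ (-N)

variable {k b N w t : ℝ}

theorem betaWeight_pos (ht : t ∈ Ioo (0 : ℝ) 1) : 0 < betaWeight k b t :=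
  mul_pos (Real.rpow_pos_of_pos ht.1 _) (Real.rpow_pos_of_pos (sub_pos.2 ht.2) _)

theorem betaWeight_add_one_left (ht : t ∈ Ioo (0 : ℝ) 1) :
    betaWeight (k + 1) b t = betaWeight k b t * t := by
  rw [betaWeight, betaWeight, add_sub_right_comm, Real.rpow_add_one ht.1.ne']
  ring

theorem betaWeight_add_one_right (ht : t ∈ Ioo (0 : ℝ) 1) :
    betaWeight k (b + 1) t = betaWeight k b t * (1 - t) := by
  rw [betaWeight, betaWeight, Real.rpow_add_one (sub_pos.2 ht.2).ne', mul_assoc]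

theorem betaWeight_sub_one_mul (ht : t ∈ Ioo (0 : ℝ) 1) :
    betaWeight k (b - 1) t * (1 - t) = betaWeight k b t := by
  rw [← betaWeight_add_one_right ht, sub_add_cancel]

@[fun_prop]
theorem measurable_betaWeight : Measurable (betaWeight k b) := by
  unfold betaWeight; fun_prop

theorem integrableOn_betaWeight (hk : 0 < k) (hb : -1 < b) :
    IntegrableOn (betaWeight k b) (Ioo 0 1) := by
  have h := Complex.betaIntegral_convergent (u := k) (v := ((b + 1 : ℝ) : ℂ)) (by simpa using hk)
    (by rw [Complex.ofReal_re]; linarith)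
  rw [intervalIntegrable_iff_integrableOn_Ioo_of_le zero_le_one] at h
  refine IntegrableOn.congr_fun h.re (fun t ht => ?_) measurableSet_Ioo
  have h0 : (t : ℂ) ^ ((k : ℂ) - 1) = ((t ^ (k - 1) : ℝ) : ℂ) := by
    rw [Complex.ofReal_cpow ht.1.le]; push_cast; rfl
  have h1 : (1 - (t : ℂ)) ^ (((b + 1 : ℝ) : ℂ) - 1) = (((1 - t) ^ b : ℝ) : ℂ) := by
    rw [Complex.ofReal_cpow (sub_pos.2 ht.2).le]; push_cast; ring_nf
  simp only [h0, h1, betaWeight, ← Complex.ofReal_mul]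
  exact Complex.ofReal_re _

theorem integrableOn_betaWeight_mul (hk : 0 < k) (hb : -1 < b) {u : ℝ → ℝ} {C : ℝ}
    (hu : Measurable u) (hC : ∀ t ∈ Ioo (0 : ℝ) 1, ‖u t‖ ≤ C) :
    IntegrableOn (fun t => betaWeight k b t * u t) (Ioo 0 1) :=
  Integrable.mul_bdd (c := C) (integrableOn_betaWeight hk hb) hu.aestronglyMeasurable
    (ae_restrict_of_forall_mem measurableSet_Ioo hC)

theorem one_add_mul_pos (hw : -1 < w) (ht : t ∈ Icc (0 : ℝ) 1) : 0 < 1 + w * t := by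
  rcases ht.1.eq_or_lt with rfl | h0
  · simp
  · nlinarith [ht.2]

theorem exists_norm_one_add_mul_rpow_le {v : ℝ} (hv : -1 < v) (w N : ℝ) :
    ∃ C, ∀ s ∈ Icc v w, ∀ t ∈ Ioo (0 : ℝ) 1, ‖(1 + s * t) ^ N‖ ≤ C := by
  have hcont : ContinuousOn (fun q : ℝ × ℝ => (1 + q.1 * q.2) ^ N) (Icc v w ×ˢ Icc 0 1) :=
    ContinuousOn.rpow_const (by fun_prop) fun q hq =>
      Or.inl (one_add_mul_pos (hv.trans_le hq.1.1) hq.2).ne'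
  obtain ⟨C, hC⟩ := (isCompact_Icc.prod isCompact_Icc).exists_bound_of_continuousOn hcont
  exact ⟨C, fun s hs t ht => hC (s, t) ⟨hs, Ioo_subset_Icc_self ht⟩⟩

theorem integrableOn_betaInt (hk : 0 < k) (hb : -1 < b) (hw : -1 < w) :
    IntegrableOn (fun t => betaWeight k b t * (1 + w * t) ^ (-N)) (Ioo 0 1) := by
  obtain ⟨C, hC⟩ := exists_norm_one_add_mul_rpow_le hw w (-N)
  exact integrableOn_betaWeight_mul hk hb (by fun_prop) (hC w (by simp))

theorem betaInt_pos (hk : 0 < k) (hb : -1 < b) (hw : -1 < w) : 0 < betaInt k b N w := by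
  have hpos : ∀ t ∈ Ioo (0 : ℝ) 1, 0 < betaWeight k b t * (1 + w * t) ^ (-N) := fun t ht =>
    mul_pos (betaWeight_pos ht)
      (Real.rpow_pos_of_pos (one_add_mul_pos hw (Ioo_subset_Icc_self ht)) _)
  have hsupport : Ioo (0 : ℝ) 1 ⊆
      Function.support fun t => betaWeight k b t * (1 + w * t) ^ (-N) := fun t ht => (hpos t ht).ne'
  rw [betaInt, setIntegral_pos_iff_support_of_nonneg_ae
    (ae_restrict_of_forall_mem measurableSet_Ioo fun t ht => (hpos t ht).le)
    (integrableOn_betaInt hk hb hw), inter_eq_right.2 hsupport]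
  simp

theorem betaInt_add_one_right (hk : 0 < k) (hb : -1 < b) (hw : -1 < w) :
    betaInt k (b + 1) N w = betaInt k b N w - betaInt (k + 1) b N w := by
  rw [betaInt, betaInt, betaInt, ← integral_sub (integrableOn_betaInt hk hb hw)
    (integrableOn_betaInt (by linarith) hb hw)]
  refine setIntegral_congr_fun measurableSet_Ioo fun t ht => ?_
  simp only [betaWeight_add_one_left ht, betaWeight_add_one_right ht]
  ring

theorem betaInt_add_one_left_lt (hk : 0 < k) (hb : -1 < b) (hw : -1 < w) :
    betaInt (k + 1) b N w < betaInt k b N w := by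
  rw [← sub_pos, ← betaInt_add_one_right hk hb hw]
  exact betaInt_pos hk (by linarith) hw

theorem betaInt_eq_add_mul (hk : 0 < k) (hb : -1 < b) (hw : -1 < w) :
    betaInt k b N w = betaInt k b (N + 1) w + w * betaInt (k + 1) b (N + 1) w := by
  rw [betaInt, betaInt, betaInt, ← integral_const_mul,
    ← integral_add (integrableOn_betaInt hk hb hw)
      ((integrableOn_betaInt (by linarith) hb hw).const_mul w)]
  refine setIntegral_congr_fun measurableSet_Ioo fun t ht => ?_
  have h : (1 + w * t) ^ (-N) = (1 + w * t) ^ (-(N + 1)) * (1 + w * t) := by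
    rw [← Real.rpow_add_one (one_add_mul_pos hw (Ioo_subset_Icc_self ht)).ne']; ring_nf
  simp only [betaWeight_add_one_left ht, h]
  ring

theorem betaInt_add_one_sq_le (hk : 0 < k) (hb : -1 < b) (hw : -1 < w) :
    betaInt k (b + 1) N w ^ 2 ≤ betaInt k b N w * betaInt k (b + 2) N w := by
  have h0 := betaInt_pos (N := N) hk hb hw
  have i0 := integrableOn_betaInt (N := N) hk hb hw
  have i1 := integrableOn_betaInt (N := N) hk (by linarith : -1 < b + 1) hw
  have i2 := integrableOn_betaInt (N := N) hk (by linarith : -1 < b + 2) hw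
  set m := betaInt k (b + 1) N w / betaInt k b N w
  have hvar : 0 ≤ ∫ t in Ioo (0 : ℝ) 1, (betaWeight k (b + 2) t * (1 + w * t) ^ (-N)
      - 2 * m * (betaWeight k (b + 1) t * (1 + w * t) ^ (-N))
      + m ^ 2 * (betaWeight k b t * (1 + w * t) ^ (-N))) := by
    refine setIntegral_nonneg measurableSet_Ioo fun t ht => ?_
    have hsq : 0 ≤ betaWeight k b t * (1 + w * t) ^ (-N) * (1 - t - m) ^ 2 :=
      mul_nonneg (mul_nonneg (betaWeight_pos ht).le (Real.rpow_nonneg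
        (one_add_mul_pos hw (Ioo_subset_Icc_self ht)).le _)) (sq_nonneg _)
    rw [show b + 2 = b + 1 + 1 by ring, betaWeight_add_one_right ht, betaWeight_add_one_right ht]
    linarith
  have hexpand : 0 ≤ betaInt k (b + 2) N w - 2 * m * betaInt k (b + 1) N w
      + m ^ 2 * betaInt k b N w := by
    refine hvar.trans_eq ((integral_add (i2.sub (i1.const_mul _)) (i0.const_mul _)).trans ?_)
    rw [integral_sub' i2 (i1.const_mul _), integral_const_mul, integral_const_mul]
    rfl
  have hmul : m * betaInt k b N w = betaInt k (b + 1) N w := div_mul_cancel₀ _ h0.ne'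
  nlinarith

theorem hasDerivAt_betaInt (hk : 0 < k) (hb : -1 < b) (hw : -1 < w) :
    HasDerivAt (betaInt k b N) (-N * betaInt (k + 1) b (N + 1) w) w := by
  have hv : -1 < (w - 1) / 2 := by linarith
  obtain ⟨C, hC⟩ := exists_norm_one_add_mul_rpow_le hv (w + 1) (-(N + 1))
  have key := hasDerivAt_integral_of_dominated_loc_of_deriv_le
    (μ := volume.restrict (Ioo (0 : ℝ) 1)) (𝕜 := ℝ)
    (F := fun w t => betaWeight k b t * (1 + w * t) ^ (-N))
    (F' := fun w t => -N * (betaWeight (k + 1) b t * (1 + w * t) ^ (-(N + 1))))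
    (bound := fun t => ‖N‖ * (betaWeight (k + 1) b t * C)) (x₀ := w)
    (s := Icc ((w - 1) / 2) (w + 1)) (Icc_mem_nhds (by linarith) (by linarith))
    (Eventually.of_forall fun w => (by fun_prop : Measurable _).aestronglyMeasurable)
    (integrableOn_betaInt hk hb hw)
    (by fun_prop : Measurable _).aestronglyMeasurable
    (ae_restrict_of_forall_mem measurableSet_Ioo fun t ht s hs => ?_)
    (((integrableOn_betaWeight (by linarith) hb).mul_const C).const_mul _)
    (ae_restrict_of_forall_mem measurableSet_Ioo fun t ht s hs => ?_)
  · convert! key.2 using 1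
    rw [betaInt, integral_const_mul]
  · have hweight := (betaWeight_pos (k := k + 1) (b := b) ht).le
    rw [norm_mul, norm_neg, norm_mul, Real.norm_of_nonneg hweight]
    gcongr
    exact hC s hs t ht
  · have hlin : HasDerivAt (fun w : ℝ => 1 + w * t) t s := by
      simpa using ((hasDerivAt_id s).mul_const t).const_add 1
    have hpos := one_add_mul_pos (hv.trans_le hs.1) (Ioo_subset_Icc_self ht)
    convert! (hlin.rpow_const (p := -N) (Or.inl hpos.ne')).const_mul (betaWeight k b t) using 1
    rw [betaWeight_add_one_left ht, neg_add']
    ring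

end BetaIntegral

section IntegrationByParts

variable {k b N w t : ℝ}

theorem hasDerivAt_betaWeight (ht : t ∈ Ioo (0 : ℝ) 1) :
    HasDerivAt (betaWeight (k + 1) (b + 1))
      (betaWeight k b t * (k * (1 - t) - (b + 1) * t)) t := by
  have hsub : HasDerivAt (fun t : ℝ => 1 - t) (-1) t := by
    simpa using (hasDerivAt_id t).const_sub 1
  have h := ((hasDerivAt_id t).rpow_const (p := k) (Or.inl ht.1.ne')).mul
    (hsub.rpow_const (p := b + 1) (Or.inl (sub_pos.2 ht.2).ne'))
  have hleft : t ^ k = t ^ (k - 1) * t := by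
    rw [← Real.rpow_add_one ht.1.ne', sub_add_cancel]
  have hright : (1 - t) ^ (b + 1) = (1 - t) ^ b * (1 - t) :=
    Real.rpow_add_one (sub_pos.2 ht.2).ne' _
  convert! h using 1
  · funext s; simp [betaWeight]
  · simp only [id, betaWeight, hleft, hright, add_sub_cancel_right]; ring

theorem tendsto_betaWeight_zero (hk : 0 < k) (hb : 0 < b) :
    Tendsto (betaWeight (k + 1) b) (𝓝[>] 0) (𝓝 0) ∧
      Tendsto (betaWeight (k + 1) b) (𝓝[<] 1) (𝓝 0) := by
  have hcont : Continuous (betaWeight (k + 1) b) := by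
    unfold betaWeight
    exact (Real.continuous_rpow_const (by linarith)).mul
      ((Real.continuous_rpow_const hb.le).comp (continuous_const.sub continuous_id))
  have h0 : betaWeight (k + 1) b 0 = 0 := by simp [betaWeight, Real.zero_rpow hk.ne']
  have h1 : betaWeight (k + 1) b 1 = 0 := by simp [betaWeight, Real.zero_rpow hb.ne']
  exact ⟨by simpa [h0] using (hcont.tendsto 0).mono_left nhdsWithin_le_nhds,
    by simpa [h1] using (hcont.tendsto 1).mono_left nhdsWithin_le_nhds⟩

theorem setIntegral_deriv_eq_zero_of_norm_le_betaWeight (hk : 0 < k) (hb : 0 < b) {C : ℝ}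
    {U U' : ℝ → ℝ} (hderiv : ∀ t ∈ Ioo (0 : ℝ) 1, HasDerivAt U (U' t) t)
    (hint : IntegrableOn U' (Ioo 0 1))
    (hU : ∀ t ∈ Ioo (0 : ℝ) 1, ‖U t‖ ≤ betaWeight (k + 1) b t * C) :
    ∫ t in Ioo (0 : ℝ) 1, U' t = 0 := by
  obtain ⟨hweight0, hweight1⟩ := tendsto_betaWeight_zero hk hb
  have hU0 : Tendsto U (𝓝[>] 0) (𝓝 0) := by
    refine squeeze_zero_norm' ?_ (by simpa using hweight0.mul_const C)
    filter_upwards [Ioo_mem_nhdsGT (zero_lt_one' ℝ)] using hU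
  have hU1 : Tendsto U (𝓝[<] 1) (𝓝 0) := by
    refine squeeze_zero_norm' ?_ (by simpa using hweight1.mul_const C)
    filter_upwards [Ioo_mem_nhdsLT (zero_lt_one' ℝ)] using hU
  have h := intervalIntegral.integral_eq_sub_of_hasDerivAt_of_tendsto zero_lt_one hderiv
    ((intervalIntegrable_iff_integrableOn_Ioo_of_le zero_le_one).2 hint) hU0 hU1
  rwa [intervalIntegral.integral_of_le zero_le_one, integral_Ioc_eq_integral_Ioo, sub_zero] at h

theorem hasDerivAt_one_add_mul_rpow (h : 0 < 1 + w * t) :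
    HasDerivAt (fun t => (1 + w * t) ^ (-N)) (-(N * w * (1 + w * t) ^ (-(N + 1)))) t := by
  have hlin : HasDerivAt (fun t : ℝ => 1 + w * t) w t := by
    simpa using ((hasDerivAt_id t).const_mul w).const_add 1
  convert! hlin.rpow_const (p := -N) (Or.inl h.ne') using 1
  rw [neg_add']
  ring

theorem mul_betaInt_eq_add (hk : 0 < k) (hb : -1 < b) (hw : -1 < w) :
    k * betaInt k (b + 1) N w =
      (b + 1) * betaInt (k + 1) b N w + N * w * betaInt (k + 1) (b + 1) (N + 1) w := by
  have i0 := integrableOn_betaInt (N := N) hk (by linarith : -1 < b + 1) hw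
  have i1 := integrableOn_betaInt (N := N) (by linarith : 0 < k + 1) hb hw
  have i2 := integrableOn_betaInt (N := N + 1) (by linarith : 0 < k + 1)
    (by linarith : -1 < b + 1) hw
  have i01 := (i0.const_mul k).sub (i1.const_mul (b + 1))
  obtain ⟨C, hC⟩ := exists_norm_one_add_mul_rpow_le hw w (-N)
  have h := setIntegral_deriv_eq_zero_of_norm_le_betaWeight
    (U := fun t => betaWeight (k + 1) (b + 1) t * (1 + w * t) ^ (-N)) (C := C) hk
    (by linarith : 0 < b + 1) (fun t ht => ?_) (i01.sub (i2.const_mul (N * w))) fun t ht => ?_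
  · rw [integral_sub' i01 (i2.const_mul _), integral_sub' (i0.const_mul _) (i1.const_mul _),
      integral_const_mul, integral_const_mul, integral_const_mul] at h
    unfold betaInt
    linarith
  · convert! (hasDerivAt_betaWeight ht).mul (hasDerivAt_one_add_mul_rpow (N := N)
      (one_add_mul_pos hw (Ioo_subset_Icc_self ht))) using 1
    simp only [Pi.sub_apply, betaWeight_add_one_left ht, betaWeight_add_one_right ht]
    ring
  · rw [norm_mul, Real.norm_of_nonneg (betaWeight_pos ht).le]
    exact mul_le_mul_of_nonneg_left (hC w (by simp) t ht) (betaWeight_pos ht).le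

theorem rpow_neg_sub_rpow_neg_le {x y : ℝ} (hx : 0 < x) (hy : 0 < y) (hN : 0 ≤ N) :
    x ^ (-N) - y ^ (-N) ≤ N * x ^ (-(N + 1)) * (y - x) := by
  have hratio : 1 - N * (y / x - 1) ≤ (y / x) ^ (-N) := by
    rw [Real.rpow_def_of_pos (div_pos hy hx)]
    have hexp := Real.add_one_le_exp (Real.log (y / x) * -N)
    have hlog := mul_le_mul_of_nonneg_left (Real.log_le_sub_one_of_pos (div_pos hy hx)) hN
    linarith
  have hsplit : x ^ (-N) = x ^ (-(N + 1)) * x := by rw [← Real.rpow_add_one hx.ne']; ring_nf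
  calc x ^ (-N) - y ^ (-N) = x ^ (-N) * (1 - (y / x) ^ (-N)) := by
        rw [mul_sub, ← Real.mul_rpow hx.le (div_pos hy hx).le, mul_div_cancel₀ _ hx.ne', mul_one]
    _ ≤ x ^ (-N) * (N * (y / x - 1)) :=
        mul_le_mul_of_nonneg_left (by linarith) (Real.rpow_nonneg hx.le _)
    _ = N * x ^ (-(N + 1)) * (y - x) := by rw [hsplit]; field_simp

/-- The chord slope on `[t, 1]` of the decreasing convex function `(1 + w t)^(-N)`, with reversed
sign. Subtracting the value at `1` is what allows integration by parts against a weight that is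
singular at `1`. -/
noncomputable def chordSlope (N w t : ℝ) : ℝ := ((1 + w * t) ^ (-N) - (1 + w) ^ (-N)) / (1 - t)

@[fun_prop]
theorem measurable_chordSlope : Measurable (chordSlope N w) := by unfold chordSlope; fun_prop

theorem chordSlope_mul (ht : t < 1) :
    chordSlope N w t * (1 - t) = (1 + w * t) ^ (-N) - (1 + w) ^ (-N) :=
  div_mul_cancel₀ _ (sub_pos.2 ht).ne'

theorem chordSlope_nonneg (hN : 0 ≤ N) (hw : 0 ≤ w) (ht : t ∈ Ioo (0 : ℝ) 1) :
    0 ≤ chordSlope N w t :=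
  div_nonneg (sub_nonneg.2 (Real.rpow_le_rpow_of_nonpos
    (one_add_mul_pos (by linarith) (Ioo_subset_Icc_self ht))
    (by linarith [mul_le_of_le_one_right hw ht.2.le]) (neg_nonpos.2 hN))) (sub_pos.2 ht.2).le

theorem chordSlope_le (hN : 0 ≤ N) (hw : 0 ≤ w) (ht : t ∈ Ioo (0 : ℝ) 1) :
    chordSlope N w t ≤ N * w * (1 + w * t) ^ (-(N + 1)) := by
  rw [chordSlope, div_le_iff₀ (sub_pos.2 ht.2)]
  have h := rpow_neg_sub_rpow_neg_le (one_add_mul_pos (by linarith) (Ioo_subset_Icc_self ht))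
    (by linarith : 0 < 1 + w) hN
  linarith

theorem hasDerivAt_betaWeight_mul_chord (hw : -1 < w) (ht : t ∈ Ioo (0 : ℝ) 1) :
    HasDerivAt (fun t => betaWeight (k + 1) b t * ((1 + w * t) ^ (-N) - (1 + w) ^ (-N)))
      (betaWeight k b t * (k * ((1 + w * t) ^ (-N) - (1 + w) ^ (-N)) - b * t * chordSlope N w t
        - N * w * t * (1 + w * t) ^ (-(N + 1)))) t := by
  have hweight := hasDerivAt_betaWeight (k := k) (b := b - 1) ht
  rw [sub_add_cancel] at hweight
  convert! hweight.mul ((hasDerivAt_one_add_mul_rpow (N := N)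
    (one_add_mul_pos hw (Ioo_subset_Icc_self ht))).sub_const ((1 + w) ^ (-N))) using 1
  rw [betaWeight_add_one_left ht, ← betaWeight_sub_one_mul ht, ← chordSlope_mul ht.2]
  ring

theorem abs_chordSlope_le (hN : 0 ≤ N) (hw : 0 ≤ w) (ht : t ∈ Ioo (0 : ℝ) 1) :
    |chordSlope N w t| ≤ N * w := by
  rw [abs_of_nonneg (chordSlope_nonneg hN hw ht)]
  exact (chordSlope_le hN hw ht).trans (mul_le_of_le_one_right (mul_nonneg hN hw)
    (Real.rpow_le_one_of_one_le_of_nonpos (by linarith [mul_nonneg hw ht.1.le]) (by linarith)))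

theorem integrableOn_betaWeight_mul_chord_deriv (hk : 0 < k) (hb : -1 < b) (hN : 0 ≤ N)
    (hw : 0 ≤ w) :
    IntegrableOn (fun t => betaWeight k b t * (k * ((1 + w * t) ^ (-N) - (1 + w) ^ (-N))
      - b * t * chordSlope N w t - N * w * t * (1 + w * t) ^ (-(N + 1)))) (Ioo 0 1) := by
  have hw1 : -1 < w := by linarith
  have i0 := integrableOn_betaInt (N := N) hk hb hw1
  have i1 := integrableOn_betaInt (N := N + 1) (by linarith : 0 < k + 1) hb hw1
  have iS : IntegrableOn (fun t => betaWeight (k + 1) b t * chordSlope N w t) (Ioo 0 1) :=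
    integrableOn_betaWeight_mul (by linarith) hb measurable_chordSlope
      fun t ht => abs_chordSlope_le hN hw ht
  refine IntegrableOn.congr_fun ((((i0.sub ((integrableOn_betaWeight hk hb).mul_const
    ((1 + w) ^ (-N)))).const_mul k).sub (iS.const_mul b)).sub (i1.const_mul (N * w)))
    (fun t ht => ?_) measurableSet_Ioo
  simp only [Pi.sub_apply, betaWeight_add_one_left ht]
  ring

theorem integral_betaWeight_mul_chord_deriv (hk : 0 < k) (hb : -1 < b) (hN : 0 ≤ N)
    (hw : 0 ≤ w) :
    ∫ t in Ioo (0 : ℝ) 1, betaWeight k b t * (k * ((1 + w * t) ^ (-N) - (1 + w) ^ (-N))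
      - b * t * chordSlope N w t - N * w * t * (1 + w * t) ^ (-(N + 1))) = 0 := by
  refine setIntegral_deriv_eq_zero_of_norm_le_betaWeight (C := N * w) hk
    (by linarith : 0 < b + 1) (fun t ht => hasDerivAt_betaWeight_mul_chord (by linarith) ht)
    (integrableOn_betaWeight_mul_chord_deriv hk hb hN hw) fun t ht => ?_
  rw [← chordSlope_mul ht.2, mul_comm (chordSlope _ _ _), ← mul_assoc,
    ← betaWeight_add_one_right ht, norm_mul, Real.norm_of_nonneg (betaWeight_pos ht).le]
  exact mul_le_mul_of_nonneg_left (abs_chordSlope_le hN hw ht) (betaWeight_pos ht).le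

theorem one_add_mul_betaInt_le_of_nonpos (hk : 0 < k) (hb : -1 < b) (hb0 : b ≤ 0) (hN : 0 ≤ N)
    (hw : 0 ≤ w) :
    (1 + b) * (N * w * betaInt (k + 1) b (N + 1) w) ≤ k * betaInt k b N w := by
  have hw1 : -1 < w := by linarith
  have i0 := integrableOn_betaInt (N := N) hk hb hw1
  have i1 := integrableOn_betaInt (N := N + 1) (by linarith : 0 < k + 1) hb hw1
  have hle := setIntegral_mono_on (integrableOn_betaWeight_mul_chord_deriv hk hb hN hw)
    ((i0.const_mul k).sub (i1.const_mul ((1 + b) * (N * w)))) measurableSet_Ioo fun t ht => ?_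
  · rw [integral_betaWeight_mul_chord_deriv hk hb hN hw,
      integral_sub' (i0.const_mul _) (i1.const_mul _), integral_const_mul, integral_const_mul]
      at hle
    unfold betaInt
    linarith
  · have hconst : 0 ≤ k * (1 + w) ^ (-N) := by positivity
    have hslope := mul_le_mul_of_nonneg_left (chordSlope_le hN hw ht)
      (mul_nonneg (neg_nonneg.2 hb0) ht.1.le)
    simp only [Pi.sub_apply, betaWeight_add_one_left ht]
    have := mul_le_mul_of_nonneg_left
      (show k * ((1 + w * t) ^ (-N) - (1 + w) ^ (-N)) - b * t * chordSlope N w t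
          - N * w * t * (1 + w * t) ^ (-(N + 1))
        ≤ k * (1 + w * t) ^ (-N) - (1 + b) * (N * w) * (t * (1 + w * t) ^ (-(N + 1))) by linarith)
      (betaWeight_pos (k := k) (b := b) ht).le
    linarith

theorem mul_betaInt_le_of_nonneg (hk : 0 < k) (hb : 0 ≤ b) (hN : 0 ≤ N) (hw : 0 ≤ w) :
    N * w * betaInt (k + 1) b (N + 1) w ≤ k * betaInt k b N w := by
  rcases hb.eq_or_lt with rfl | hb
  · simpa using one_add_mul_betaInt_le_of_nonpos hk (by norm_num) le_rfl hN hw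
  · have h := mul_betaInt_eq_add (b := b - 1) (N := N) hk (by linarith) (by linarith : -1 < w)
    have hpos := betaInt_pos (k := k + 1) (b := b - 1) (N := N) (by linarith) (by linarith)
      (by linarith : -1 < w)
    rw [sub_add_cancel] at h
    nlinarith

end IntegrationByParts

section Shrink

/-- The mean of the density proportional to `t^(k-1) (1-t)^b (1+wt)^(-N)` on `(0, 1)`, which
turns out to be the factor by which the generalized Bayes estimator shrinks `x` when
`w = ‖x‖² / ‖z‖²`. -/
noncomputable def shrink (k b N w : ℝ) : ℝ := betaInt (k + 1) b N w / betaInt k b N w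

/-- The derivative of `shrink k b N`. -/
noncomputable def shrinkDeriv (k b N w : ℝ) : ℝ :=
  (N * betaInt (k + 1) b (N + 1) w * betaInt (k + 1) b N w
    - N * betaInt (k + 2) b (N + 1) w * betaInt k b N w) / betaInt k b N w ^ 2

variable {k b N w : ℝ}

@[fun_prop]
theorem measurable_betaInt : Measurable (betaInt k b N) := by
  have h : StronglyMeasurable (fun q : ℝ × ℝ => betaWeight k b q.2 * (1 + q.1 * q.2) ^ (-N)) :=
    (by fun_prop : Measurable _).stronglyMeasurable
  exact (h.integral_prod_right (ν := volume.restrict (Ioo (0 : ℝ) 1))).measurable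

theorem measurable_shrink : Measurable (shrink k b N) := by unfold shrink; fun_prop

theorem measurable_shrinkDeriv : Measurable (shrinkDeriv k b N) := by unfold shrinkDeriv; fun_prop

theorem shrink_pos (hk : 0 < k) (hb : -1 < b) (hw : -1 < w) : 0 < shrink k b N w :=
  div_pos (betaInt_pos (by linarith) hb hw) (betaInt_pos hk hb hw)

theorem shrink_lt_one (hk : 0 < k) (hb : -1 < b) (hw : -1 < w) : shrink k b N w < 1 :=
  (div_lt_one (betaInt_pos hk hb hw)).2 (betaInt_add_one_left_lt hk hb hw)

theorem hasDerivAt_shrink (hk : 0 < k) (hb : -1 < b) (hw : -1 < w) :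
    HasDerivAt (shrink k b N) (shrinkDeriv k b N w) w := by
  have h := (hasDerivAt_betaInt (k := k + 1) (N := N) (by linarith) hb hw).div
    (hasDerivAt_betaInt (N := N) hk hb hw) (betaInt_pos hk hb hw).ne'
  convert! h using 1
  rw [shrinkDeriv, show k + 1 + 1 = k + 2 by ring]
  ring

theorem mul_shrink_le_of_mul_betaInt_le {c : ℝ} (hk : 0 < k) (hb : -1 < b) (hw : -1 < w)
    (hpos : 0 < c * (N - 1) - k)
    (h : c * ((N - 1) * w * betaInt (k + 1) b N w) ≤ k * betaInt k b (N - 1) w) :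
    w * shrink k b N w ≤ k / (c * (N - 1) - k) := by
  rw [betaInt_eq_add_mul (N := N - 1) hk hb hw, sub_add_cancel] at h
  rw [le_div_iff₀ hpos, shrink, mul_div_assoc', div_mul_eq_mul_div,
    div_le_iff₀ (betaInt_pos hk hb hw)]
  linarith

theorem mul_shrink_le_of_nonneg (hk : 0 < k) (hb : 0 ≤ b) (hN : k + 1 < N) (hw : 0 ≤ w) :
    w * shrink k b N w ≤ k / (N - 1 - k) := by
  have h := mul_betaInt_le_of_nonneg (N := N - 1) hk hb (by linarith) hw
  rw [sub_add_cancel] at h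
  simpa using mul_shrink_le_of_mul_betaInt_le (c := 1) hk (by linarith) (by linarith)
    (by linarith) (by linarith)

theorem mul_shrink_le_of_nonpos (hk : 0 < k) (hb : -1 < b) (hb0 : b ≤ 0) (hN : 1 ≤ N)
    (hpos : 0 < (1 + b) * (N - 1) - k) (hw : 0 ≤ w) :
    w * shrink k b N w ≤ k / ((1 + b) * (N - 1) - k) := by
  have h := one_add_mul_betaInt_le_of_nonpos (N := N - 1) hk hb hb0 (by linarith) hw
  rw [sub_add_cancel] at h
  exact mul_shrink_le_of_mul_betaInt_le hk hb (by linarith) hpos h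

theorem abs_mul_shrinkDeriv_le (hk : 0 < k) (hb : -1 < b) (hN : 0 ≤ N) (hw : 0 ≤ w) :
    |w * shrinkDeriv k b N w| ≤ N := by
  have hw1 : -1 < w := by linarith
  have h0 := betaInt_pos (N := N) hk hb hw1
  have h1 := betaInt_pos (k := k + 1) (N := N) (by linarith) hb hw1
  have hlt := betaInt_add_one_left_lt (N := N) hk hb hw1
  have j0 := betaInt_pos (N := N + 1) hk hb hw1
  have j1 := betaInt_pos (k := k + 1) (N := N + 1) (by linarith) hb hw1
  have j2 := betaInt_pos (k := k + 2) (N := N + 1) (by linarith) hb hw1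
  have e0 := betaInt_eq_add_mul (N := N) hk hb hw1
  have e1 := betaInt_eq_add_mul (k := k + 1) (N := N) (by linarith) hb hw1
  rw [show k + 1 + 1 = k + 2 by ring] at e1
  have hfirst : w * betaInt (k + 1) b (N + 1) w * betaInt (k + 1) b N w ≤ betaInt k b N w ^ 2 := by
    rw [sq]; exact mul_le_mul (by linarith) hlt.le h1.le h0.le
  have hsecond : w * betaInt (k + 2) b (N + 1) w * betaInt k b N w ≤ betaInt k b N w ^ 2 := by
    rw [sq]; exact mul_le_mul_of_nonneg_right (by linarith) h0.le
  have hfirst0 : 0 ≤ w * betaInt (k + 1) b (N + 1) w * betaInt (k + 1) b N w := by positivity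
  have hsecond0 : 0 ≤ w * betaInt (k + 2) b (N + 1) w * betaInt k b N w := by positivity
  have heq : w * shrinkDeriv k b N w = N * ((w * betaInt (k + 1) b (N + 1) w * betaInt (k + 1) b N w
      - w * betaInt (k + 2) b (N + 1) w * betaInt k b N w) / betaInt k b N w ^ 2) := by
    rw [shrinkDeriv]; ring
  rw [heq, abs_mul, abs_of_nonneg hN, abs_div, abs_of_pos (pow_pos h0 2)]
  exact mul_le_of_le_one_right hN ((div_le_one (pow_pos h0 2)).2
    (abs_sub_le_of_nonneg_of_le hfirst0 hfirst hsecond0 hsecond))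

theorem mul_shrinkDeriv_eq (hk : 0 < k) (hb : -1 < b) (hw : -1 < w) :
    w * shrinkDeriv k b N w = shrink k b N w * (-1 - b + (1 - shrink k b N w) *
      ((k * betaInt k b N w - N * w * betaInt (k + 1) b (N + 1) w) / betaInt (k + 1) b N w)) := by
  have h0 := betaInt_pos (N := N) hk hb hw
  have h1 := betaInt_pos (k := k + 1) (N := N) (by linarith) hb hw
  have h := mul_betaInt_eq_add (N := N) hk hb hw
  rw [betaInt_add_one_right hk hb hw, betaInt_add_one_right (by linarith) hb hw,
    show k + 1 + 1 = k + 2 by ring] at h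
  rw [shrinkDeriv, shrink]
  field_simp
  linear_combination (-betaInt k b N w) * h

theorem le_one_sub_shrink_mul (hk : 0 < k) (hb : 0 ≤ b) (hN : 0 ≤ N) (hw : 0 ≤ w) :
    b ≤ (1 - shrink k b N w) *
      ((k * betaInt k b N w - N * w * betaInt (k + 1) b (N + 1) w) / betaInt (k + 1) b N w) := by
  have hw1 : -1 < w := by linarith
  have hb1 : -1 < b := by linarith
  have h1 := betaInt_pos (k := k + 1) (N := N) (by linarith) hb1 hw1
  rcases hb.eq_or_lt with rfl | hb0
  · exact mul_nonneg (sub_nonneg.2 (shrink_lt_one hk hb1 hw1).le)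
      (div_nonneg (sub_nonneg.2 (mul_betaInt_le_of_nonneg hk le_rfl hN hw)) h1.le)
  · have h0 := betaInt_pos (N := N) hk hb1 hw1
    have hparts := mul_betaInt_eq_add (b := b - 1) (N := N) hk (by linarith) hw1
    have hdiff := betaInt_add_one_right (b := b - 1) (N := N) hk (by linarith) hw1
    have hconvex := betaInt_add_one_sq_le (b := b - 1) (N := N) hk (by linarith) hw1
    rw [sub_add_cancel] at hparts hdiff hconvex
    rw [show b - 1 + 2 = b + 1 by ring, betaInt_add_one_right hk hb1 hw1] at hconvex
    rw [shrink, one_sub_div h0.ne', div_mul_div_comm, le_div_iff₀ (mul_pos h0 h1), hparts,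
      add_sub_cancel_right, mul_left_comm (_ - _) b]
    refine mul_le_mul_of_nonneg_left ?_ hb
    linear_combination hconvex + (betaInt (k + 1) b N w - betaInt k b N w) * hdiff

theorem neg_shrink_le_of_nonneg (hk : 0 < k) (hb : 0 ≤ b) (hN : 0 ≤ N) (hw : 0 ≤ w) :
    -shrink k b N w ≤ w * shrinkDeriv k b N w := by
  have hb1 : -1 < b := by linarith
  have hw1 : -1 < w := by linarith
  have h := mul_le_mul_of_nonneg_left (le_one_sub_shrink_mul hk hb hN hw)
    (shrink_pos (N := N) hk hb1 hw1).le
  rw [mul_shrinkDeriv_eq hk hb1 hw1]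
  linarith

theorem add_div_le_one_sub_shrink_mul (hk : 0 < k) (hb : -1 < b) (hb0 : b ≤ 0) (hN : 0 ≤ N)
    (hw : 0 ≤ w) :
    b + b * (k + 1) / (1 + b) ≤ (1 - shrink k b N w) *
      ((k * betaInt k b N w - N * w * betaInt (k + 1) b (N + 1) w) / betaInt (k + 1) b N w) := by
  have hw1 : -1 < w := by linarith
  have hb1 : 0 < 1 + b := by linarith
  have h1 := betaInt_pos (k := k + 1) (N := N) (by linarith) hb hw1
  have hbound := one_add_mul_betaInt_le_of_nonpos (k := k + 1) (by linarith) hb hb0 hN hw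
  have hparts := mul_betaInt_eq_add (N := N) hk hb hw1
  rw [betaInt_add_one_right hk hb hw1, betaInt_add_one_right (by linarith) hb hw1] at hparts
  have hneg : b + b * (k + 1) / (1 + b) ≤ 0 :=
    add_nonpos hb0 (div_nonpos_of_nonpos_of_nonneg
      (mul_nonpos_of_nonpos_of_nonneg hb0 (by linarith)) hb1.le)
  have hquot : b + b * (k + 1) / (1 + b)
      ≤ (k * betaInt k b N w - N * w * betaInt (k + 1) b (N + 1) w) / betaInt (k + 1) b N w := by
    have hsplit : (b + b * (k + 1) / (1 + b)) * betaInt (k + 1) b N w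
        = (k + 1 + b) * betaInt (k + 1) b N w - (k + 1) * betaInt (k + 1) b N w / (1 + b) := by
      field_simp; ring
    have hterm : N * w * betaInt (k + 1 + 1) b (N + 1) w
        ≤ (k + 1) * betaInt (k + 1) b N w / (1 + b) := by
      rw [le_div_iff₀ hb1]; linarith
    rw [le_div_iff₀ h1, hsplit]
    linarith
  calc b + b * (k + 1) / (1 + b)
      ≤ (1 - shrink k b N w) * (b + b * (k + 1) / (1 + b)) := by
        linarith [mul_nonneg_of_nonpos_of_nonpos hneg
          (neg_nonpos.2 (shrink_pos (N := N) hk hb hw1).le)]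
    _ ≤ _ := mul_le_mul_of_nonneg_left hquot (sub_nonneg.2 (shrink_lt_one hk hb hw1).le)

theorem neg_mul_shrink_le_of_nonpos (hk : 0 < k) (hb : -1 < b) (hb0 : b ≤ 0) (hN : 0 ≤ N)
    (hw : 0 ≤ w) :
    -(1 + -b * (k + 1) / (1 + b)) * shrink k b N w ≤ w * shrinkDeriv k b N w := by
  have hw1 : -1 < w := by linarith
  have h := mul_le_mul_of_nonneg_left (add_div_le_one_sub_shrink_mul hk hb hb0 hN hw)
    (shrink_pos (N := N) hk hb hw1).le
  rw [mul_shrinkDeriv_eq hk hb hw1, neg_mul b, neg_div]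
  linarith

end Shrink

section DominatingShrinkage

/-- The conditions on a factor `r`, with derivative `r'`, under which the estimator
`(1 - r (‖x‖² / ‖z‖²)) x` is at least as good as `x`. The differential inequality says that the
unbiased estimator of the difference of their risks is nonpositive. -/
structure IsDominatingShrinkage (p n : ℕ) (r r' : ℝ → ℝ) : Prop where
  measurable : Measurable r
  measurable_deriv : Measurable r'
  hasDerivAt : ∀ w, 0 ≤ w → HasDerivAt r (r' w) w
  nonneg : ∀ w, 0 ≤ w → 0 ≤ r w
  le_one : ∀ w, 0 ≤ w → r w ≤ 1
  bounded : ∃ B, ∀ w, 0 ≤ w → w * r w ≤ B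
  bounded_deriv : ∃ C, ∀ w, 0 ≤ w → |w * r' w| ≤ C
  div_nonpos : ∀ w, 0 ≤ w → -2 * p * r w - 4 * (w * r' w) + (n - 2) * (w * r w) * r w
    - 4 * (w * r w) * (w * r' w) ≤ 0

variable {p n : ℕ} {k b N : ℝ}

theorem stein_div_nonpos {p n r s w L B : ℝ} (hr : 0 ≤ r) (hw : 0 ≤ w) (hL : 0 ≤ L)
    (hn : 0 ≤ n) (hs : -(1 + L) * r ≤ s) (hB : w * r ≤ B)
    (h : B * (n + 2 + 4 * L) ≤ 2 * (p - 2) - 4 * L) :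
    -2 * p * r - 4 * s + (n - 2) * (w * r) * r - 4 * (w * r) * s ≤ 0 := by
  have hwr : 0 ≤ w * r := mul_nonneg hw hr
  have hfactor : w * r * (n + 2 + 4 * L) ≤ 2 * (p - 2) - 4 * L :=
    (mul_le_mul_of_nonneg_right hB (by linarith)).trans h
  have hslope := mul_le_mul_of_nonneg_left hs (show 0 ≤ 4 * (1 + w * r) by linarith)
  linarith [mul_le_mul_of_nonneg_left hfactor hr]

theorem isDominatingShrinkage_of_bounds {L B : ℝ} (hk : 0 < k) (hb : -1 < b)
    (hN : 0 ≤ N) (hL : 0 ≤ L) (hB : ∀ w, 0 ≤ w → w * shrink k b N w ≤ B)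
    (hs : ∀ w, 0 ≤ w → -(1 + L) * shrink k b N w ≤ w * shrinkDeriv k b N w)
    (h : B * (n + 2 + 4 * L) ≤ 2 * (p - 2) - 4 * L) :
    IsDominatingShrinkage p n (shrink k b N) (shrinkDeriv k b N) where
  measurable := measurable_shrink
  measurable_deriv := measurable_shrinkDeriv
  hasDerivAt w hw := hasDerivAt_shrink hk hb (by linarith)
  nonneg w hw := (shrink_pos hk hb (by linarith)).le
  le_one w hw := (shrink_lt_one hk hb (by linarith)).le
  bounded := ⟨B, hB⟩
  bounded_deriv := ⟨N, fun w hw => abs_mul_shrinkDeriv_le hk hb hN hw⟩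
  div_nonpos w hw := stein_div_nonpos (shrink_pos hk hb (by linarith)).le hw hL
    (Nat.cast_nonneg n) (hs w hw) (hB w hw) h

theorem isDominatingShrinkage_of_nonneg (hk : 0 < k) (hb : 0 ≤ b) (hN : k + 1 < N)
    (h : k * (n + 2) ≤ 2 * (p - 2) * (N - 1 - k)) :
    IsDominatingShrinkage p n (shrink k b N) (shrinkDeriv k b N) := by
  have hN0 : 0 ≤ N := by linarith
  refine isDominatingShrinkage_of_bounds (L := 0) hk (by linarith) hN0 le_rfl
    (fun w hw => mul_shrink_le_of_nonneg hk hb hN hw)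
    (fun w hw => by simpa using neg_shrink_le_of_nonneg hk hb hN0 hw) ?_
  rw [div_mul_eq_mul_div, div_le_iff₀ (by linarith)]
  linarith

theorem isDominatingShrinkage_of_nonpos (hk : 0 < k) (hb : -1 < b) (hb0 : b ≤ 0)
    (hN : 1 ≤ N) (hpos : 0 < (1 + b) * (N - 1) - k)
    (h : k * (n + 2 + 4 * (-b * (k + 1) / (1 + b))) ≤
      (2 * (p - 2) - 4 * (-b * (k + 1) / (1 + b))) * ((1 + b) * (N - 1) - k)) :
    IsDominatingShrinkage p n (shrink k b N) (shrinkDeriv k b N) := by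
  have hL : 0 ≤ -b * (k + 1) / (1 + b) :=
    div_nonneg (mul_nonneg (by linarith) (by linarith)) (by linarith)
  refine isDominatingShrinkage_of_bounds hk hb (by linarith) hL
    (fun w hw => mul_shrink_le_of_nonpos hk hb hb0 hN hpos hw)
    (fun w hw => neg_mul_shrink_le_of_nonpos hk hb hb0 (by linarith) hw) ?_
  rw [div_mul_eq_mul_div, div_le_iff₀ hpos]
  linarith

end DominatingShrinkage

section

variable {E : Type*} [NormedAddCommGroup E]

theorem norm_le_of_norm_sub_sq_add_lt {u y : E} {c T : ℝ} (hc : 0 ≤ c)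
    (h : ‖y - u‖ ^ 2 + c < T) : ‖y‖ ≤ ‖u‖ + (T + 1) := by
  have htriangle : ‖y‖ ≤ ‖u‖ + ‖y - u‖ := by simpa using norm_add_le u (y - u)
  linarith [sq_nonneg (‖y - u‖ - 1), sq_nonneg ‖y - u‖]

theorem integrable_bounded_mul_continuous_mul_comp [ProperSpace E] [MeasurableSpace E]
    [BorelSpace E] {μ : Measure E} [IsFiniteMeasureOnCompacts μ] {h ℓ m : E → ℝ} {ψ : ℝ → ℝ}
    {C R T : ℝ} (hh : Measurable h) (hC : ∀ y, |h y| ≤ C) (hℓ : Continuous ℓ) (hψ : Continuous ψ)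
    (hψ0 : ∀ t, T ≤ t → ψ t = 0) (hm : Continuous m) (hR : ∀ y, m y < T → ‖y‖ ≤ R) :
    Integrable (fun y => h y * (ℓ y * ψ (m y))) μ := by
  have hsupport : HasCompactSupport fun y => ψ (m y) :=
    HasCompactSupport.intro (isCompact_closedBall 0 R) fun y hy => hψ0 _ <| not_lt.1 fun hlt =>
      hy (mem_closedBall_zero_iff.2 (hR y hlt))
  exact ((hℓ.mul (hψ.comp hm)).integrable_of_hasCompactSupport hsupport.mul_left).bdd_mul
    hh.aestronglyMeasurable (ae_of_all μ hC)

end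

section HalfTail

variable {f : ℝ → ℝ} {T t : ℝ}

/-- For `f` vanishing beyond `T`, this is `½ ∫_t^∞ f`, the function that replaces `f` on the
differentiated side of Stein's identity. -/
noncomputable def halfTail (f : ℝ → ℝ) (T t : ℝ) : ℝ := (1 / 2) * ∫ s in t..T, f s

theorem hasDerivAt_halfTail (hf : Continuous f) (T t : ℝ) :
    HasDerivAt (halfTail f T) (-(f t / 2)) t := by
  have h := (intervalIntegral.integral_hasDerivAt_left (hf.intervalIntegrable t T)
    (hf.stronglyMeasurableAtFilter _ _) hf.continuousAt).const_mul (1 / 2 : ℝ)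
  rwa [mul_neg, one_div_mul_eq_div] at h

theorem continuous_halfTail (hf : Continuous f) (T : ℝ) : Continuous (halfTail f T) :=
  continuous_iff_continuousAt.2 fun t => (hasDerivAt_halfTail hf T t).continuousAt

theorem halfTail_eq_zero (hT : ∀ s, T ≤ s → f s = 0) (ht : T ≤ t) : halfTail f T t = 0 := by
  have hzero : EqOn f (fun _ => 0) (uIcc T t) := fun s hs => hT s (uIcc_of_le ht ▸ hs).1
  rw [halfTail, intervalIntegral.integral_symm, intervalIntegral.integral_congr hzero,
    intervalIntegral.integral_zero, neg_zero, mul_zero]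

theorem halfTail_nonneg (hf0 : ∀ s, 0 ≤ f s) (hT : ∀ s, T ≤ s → f s = 0) (t : ℝ) :
    0 ≤ halfTail f T t := by
  rcases le_total t T with h | h
  · exact mul_nonneg one_half_pos.le (intervalIntegral.integral_nonneg h fun s _ => hf0 s)
  · exact (halfTail_eq_zero hT h).ge

end HalfTail

section Stein

variable {d : ℕ} {f φ φ' : ℝ → ℝ} {T c : ℝ}

theorem hasLineDerivAt_halfTail (hf : Continuous f) (u y : Euc d) (i : Fin d) :
    HasLineDerivAt ℝ (fun y => halfTail f T (‖y - u‖ ^ 2 + c))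
      (-((y i - u i) * f (‖y - u‖ ^ 2 + c))) y (EuclideanSpace.single i 1) := by
  have h := ((hasDerivAt_halfTail hf T _).comp_hasFDerivAt y
    (((hasFDerivAt_id y).sub_const u).norm_sq.add_const c)).hasLineDerivAt
    (EuclideanSpace.single i 1)
  convert! h using 1
  simp [EuclideanSpace.inner_single_right]
  ring

/-- The conditions on `φ`, with derivative `φ'`, under which Stein's identity applies to the
vector field `φ (‖y‖ ^ 2) • y`. -/
structure IsRadialMultiplier (φ φ' : ℝ → ℝ) : Prop where
  measurable : Measurable φ
  measurable_deriv : Measurable φ'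
  continuousWithinAt_zero : ContinuousWithinAt φ (Ici 0) 0
  hasDerivAt : ∀ t, 0 < t → HasDerivAt φ (φ' t) t
  bounded : ∃ B, ∀ t, 0 ≤ t → |φ t| ≤ B
  bounded_deriv : ∃ C, ∀ t, 0 ≤ t → |t * φ' t| ≤ C

theorem hasDerivAt_comp_sq_mul_zero (hφ : ContinuousWithinAt φ (Ici 0) 0) :
    HasDerivAt (fun t => φ (t ^ 2) * t) (φ 0) 0 := by
  have hcont : Tendsto (fun t : ℝ => φ (t ^ 2)) (𝓝[≠] 0) (𝓝 (φ 0)) :=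
    hφ.tendsto.comp (tendsto_nhdsWithin_iff.2
      ⟨((continuous_pow 2).tendsto' 0 0 (zero_pow two_ne_zero)).mono_left nhdsWithin_le_nhds,
        Eventually.of_forall sq_nonneg⟩)
  rw [hasDerivAt_iff_tendsto_slope]
  refine hcont.congr' (eventually_nhdsWithin_of_forall fun t ht => ?_)
  rw [slope_def_field, mul_zero, sub_zero, sub_zero, mul_div_cancel_right₀ _ ht]

theorem IsRadialMultiplier.hasLineDerivAt (hφ : IsRadialMultiplier φ φ') (y : Euc d) (i : Fin d) :
    HasLineDerivAt ℝ (fun y : Euc d => φ (‖y‖ ^ 2) * y i)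
      (φ (‖y‖ ^ 2) + 2 * (φ' (‖y‖ ^ 2) * y i ^ 2)) y (EuclideanSpace.single i 1) := by
  rcases eq_or_ne y 0 with rfl | hy
  · have h := hasDerivAt_comp_sq_mul_zero hφ.continuousWithinAt_zero
    simpa [HasLineDerivAt, norm_smul] using h
  · have h := (((hφ.hasDerivAt _ (by positivity)).comp_hasFDerivAt y
      (hasFDerivAt_id y).norm_sq).mul
        ((EuclideanSpace.proj (𝕜 := ℝ) i).hasFDerivAt (x := y))).hasLineDerivAt
      (EuclideanSpace.single i 1)
    convert! h using 1
    simp [EuclideanSpace.inner_single_right]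
    ring

theorem abs_mul_coord_sq_le (a : ℝ) (y : Euc d) (i : Fin d) : |a * y i ^ 2| ≤ |‖y‖ ^ 2 * a| := by
  rw [mul_comm, abs_mul, abs_mul, abs_pow, abs_pow, abs_norm]
  gcongr
  exact PiLp.norm_apply_le y i

theorem IsRadialMultiplier.exists_abs_deriv_le (hφ : IsRadialMultiplier φ φ') :
    ∃ C, ∀ (y : Euc d) (i : Fin d), |φ (‖y‖ ^ 2) + 2 * (φ' (‖y‖ ^ 2) * y i ^ 2)| ≤ C := by
  obtain ⟨B, hB⟩ := hφ.bounded
  obtain ⟨C, hC⟩ := hφ.bounded_deriv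
  refine ⟨B + 2 * C, fun y i => (abs_add_le _ _).trans (add_le_add (hB _ (sq_nonneg _)) ?_)⟩
  rw [abs_mul, abs_two]
  exact mul_le_mul_of_nonneg_left
    ((abs_mul_coord_sq_le _ y i).trans (hC _ (sq_nonneg _))) two_pos.le

theorem IsRadialMultiplier.integrable_mul_coord (hφ : IsRadialMultiplier φ φ') (hc : 0 ≤ c)
    (u : Euc d) {ℓ : Euc d → ℝ} (hℓ : Continuous ℓ) {ψ : ℝ → ℝ} (hψ : Continuous ψ)
    (hψ0 : ∀ t, T ≤ t → ψ t = 0) :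
    Integrable fun y : Euc d => φ (‖y‖ ^ 2) * (ℓ y * ψ (‖y - u‖ ^ 2 + c)) := by
  obtain ⟨B, hB⟩ := hφ.bounded
  exact integrable_bounded_mul_continuous_mul_comp (hφ.measurable.comp (by fun_prop))
    (fun y => hB _ (sq_nonneg _)) hℓ hψ hψ0 (by fun_prop)
    fun y => norm_le_of_norm_sub_sq_add_lt hc

theorem IsRadialMultiplier.integrable_deriv_mul (hφ : IsRadialMultiplier φ φ') (hc : 0 ≤ c)
    (u : Euc d) (i : Fin d) {ψ : ℝ → ℝ} (hψ : Continuous ψ) (hψ0 : ∀ t, T ≤ t → ψ t = 0) :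
    Integrable fun y : Euc d =>
      (φ (‖y‖ ^ 2) + 2 * (φ' (‖y‖ ^ 2) * y i ^ 2)) * ψ (‖y - u‖ ^ 2 + c) := by
  obtain ⟨C, hC⟩ := hφ.exists_abs_deriv_le (d := d)
  have hmeas := hφ.measurable
  have hmeas' := hφ.measurable_deriv
  simpa only [one_mul] using integrable_bounded_mul_continuous_mul_comp
    (μ := volume) (ℓ := fun _ => 1) (m := fun y : Euc d => ‖y - u‖ ^ 2 + c) (by fun_prop)
    (fun y => hC y i) continuous_const hψ hψ0 (by fun_prop)
    fun y => norm_le_of_norm_sub_sq_add_lt hc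

theorem IsRadialMultiplier.integral_mul_coord (hφ : IsRadialMultiplier φ φ') (hf : Continuous f)
    (hT : ∀ s, T ≤ s → f s = 0) (hc : 0 ≤ c) (u : Euc d) (i : Fin d) :
    ∫ y : Euc d, φ (‖y‖ ^ 2) * (y i * (y i - u i) * f (‖y - u‖ ^ 2 + c))
      = ∫ y : Euc d, (φ (‖y‖ ^ 2) + 2 * (φ' (‖y‖ ^ 2) * y i ^ 2))
          * halfTail f T (‖y - u‖ ^ 2 + c) := by
  have hF := continuous_halfTail hf T
  have hF0 : ∀ t, T ≤ t → halfTail f T t = 0 := fun t => halfTail_eq_zero hT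
  have key := integral_bilinear_hasLineDerivAt_right_eq_neg_left_of_integrable
    (μ := (volume : Measure (Euc d))) (B := ContinuousLinearMap.mul ℝ ℝ)
    (hφ.integrable_deriv_mul hc u i hF hF0)
    ((hφ.integrable_mul_coord hc u (ℓ := fun y => y i * (y i - u i)) (by fun_prop) hf hT).neg.congr
      (ae_of_all _ fun y => by
        simp only [Pi.neg_apply, ContinuousLinearMap.mul_apply']
        ring))
    ((hφ.integrable_mul_coord hc u (ℓ := fun y => y i) (by fun_prop) hF hF0).congr
      (ae_of_all _ fun y => by
        simp only [ContinuousLinearMap.mul_apply']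
        ring))
    (fun y _ => hφ.hasLineDerivAt y i) (fun y _ => hasLineDerivAt_halfTail hf u y i)
  simp only [ContinuousLinearMap.mul_apply'] at key
  rw [← neg_inj, ← key, ← integral_neg]
  exact integral_congr_ae (ae_of_all _ fun y => by ring)

theorem IsRadialMultiplier.integral_mul_inner (hφ : IsRadialMultiplier φ φ') (hf : Continuous f)
    (hT : ∀ s, T ≤ s → f s = 0) (hc : 0 ≤ c) (u : Euc d) :
    ∫ y : Euc d, φ (‖y‖ ^ 2) * (inner ℝ y (y - u) * f (‖y - u‖ ^ 2 + c))
      = ∫ y : Euc d, (d * φ (‖y‖ ^ 2) + 2 * (‖y‖ ^ 2 * φ' (‖y‖ ^ 2)))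
          * halfTail f T (‖y - u‖ ^ 2 + c) := by
  have hleft : ∀ y : Euc d, φ (‖y‖ ^ 2) * (inner ℝ y (y - u) * f (‖y - u‖ ^ 2 + c))
      = ∑ i, φ (‖y‖ ^ 2) * (y i * (y i - u i) * f (‖y - u‖ ^ 2 + c)) := fun y => by
    rw [← Finset.mul_sum, ← Finset.sum_mul, real_inner_comm, PiLp.inner_apply]
    rfl
  have hright : ∀ y : Euc d, (d * φ (‖y‖ ^ 2) + 2 * (‖y‖ ^ 2 * φ' (‖y‖ ^ 2)))
        * halfTail f T (‖y - u‖ ^ 2 + c)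
      = ∑ i, (φ (‖y‖ ^ 2) + 2 * (φ' (‖y‖ ^ 2) * y i ^ 2))
          * halfTail f T (‖y - u‖ ^ 2 + c) := fun y => by
    rw [← Finset.sum_mul, Finset.sum_add_distrib, ← Finset.mul_sum, ← Finset.mul_sum,
      ← EuclideanSpace.real_norm_sq_eq, Finset.sum_const, Finset.card_univ, Fintype.card_fin,
      nsmul_eq_mul, mul_comm (φ' _)]
  simp only [hleft, hright]
  rw [integral_finsetSum _ fun i _ => hφ.integrable_mul_coord hc u (by fun_prop) hf hT,
    integral_finsetSum _ fun i _ => hφ.integrable_deriv_mul hc u i (continuous_halfTail hf T)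
      fun t => halfTail_eq_zero hT]
  exact Finset.sum_congr rfl fun i _ => hφ.integral_mul_coord hf hT hc u i

end Stein

section Domination

variable {p n : ℕ} {r r' f : ℝ → ℝ} {T : ℝ}

namespace IsDominatingShrinkage

theorem abs_le_one (hr : IsDominatingShrinkage p n r r') {w : ℝ} (hw : 0 ≤ w) : |r w| ≤ 1 :=
  (abs_of_nonneg (hr.nonneg w hw)).trans_le (hr.le_one w hw)

theorem exists_abs_mul_le (hr : IsDominatingShrinkage p n r r') :
    ∃ B, 0 ≤ B ∧ ∀ w, 0 ≤ w → |w * r w| ≤ B := by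
  obtain ⟨B, hB⟩ := hr.bounded
  exact ⟨B, by simpa using hB 0 le_rfl, fun w hw =>
    (abs_of_nonneg (mul_nonneg hw (hr.nonneg w hw))).trans_le (hB w hw)⟩

theorem exists_abs_mul_mul_sub_le (hr : IsDominatingShrinkage p n r r') (α β : ℝ) :
    ∃ C, ∀ w, 0 ≤ w → |α * (w * r w) * r w - β * (w * r w) * (w * r' w)| ≤ C := by
  obtain ⟨B, hB0, hB⟩ := hr.exists_abs_mul_le
  obtain ⟨C, hC⟩ := hr.bounded_deriv
  refine ⟨|α| * B * 1 + |β| * B * C, fun w hw => (abs_sub _ _).trans ?_⟩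
  simp only [abs_mul α, abs_mul β, abs_mul (_ * _)]
  gcongr
  exacts [hB w hw, hr.abs_le_one hw, hB w hw, hC w hw]

theorem isRadialMultiplier_div_const (hr : IsDominatingShrinkage p n r r') {s : ℝ} (hs : 0 < s) :
    IsRadialMultiplier (fun t => r (t / s)) (fun t => r' (t / s) / s) where
  measurable := hr.measurable.comp (by fun_prop)
  measurable_deriv := (hr.measurable_deriv.comp (by fun_prop)).div_const s
  continuousWithinAt_zero :=
    (ContinuousAt.comp (f := fun t => t / s) (hr.hasDerivAt (0 / s) (zero_div s).ge).continuousAt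
      (by fun_prop)).continuousWithinAt
  hasDerivAt t ht :=
    ((hr.hasDerivAt (t / s) (by positivity)).comp t
      ((hasDerivAt_id t).div_const s)).congr_deriv (mul_one_div _ _)
  bounded := ⟨1, fun t ht => hr.abs_le_one (by positivity)⟩
  bounded_deriv := by
    obtain ⟨C, hC⟩ := hr.bounded_deriv
    refine ⟨C, fun t ht => ?_⟩
    rw [← mul_div_assoc, mul_div_right_comm]
    exact hC _ (by positivity)

theorem continuousWithinAt_const_div (hr : IsDominatingShrinkage p n r r') {A : ℝ} (hA : 0 < A) :
    ContinuousWithinAt (fun t => A / t * r (A / t) * r (A / t)) (Ici 0) 0 := by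
  obtain ⟨B, -, hB⟩ := hr.exists_abs_mul_le
  have hbound : ∀ t ∈ Ici (0 : ℝ), ‖A / t * r (A / t) * r (A / t)‖ ≤ B ^ 2 / A * t := by
    intro t ht
    rcases (mem_Ici.1 ht).eq_or_lt with rfl | ht0
    · simp
    · have hw : 0 < A / t := by positivity
      have heq : A / t * r (A / t) * r (A / t) = (A / t * r (A / t)) ^ 2 / A * t := by
        field_simp
      rw [heq, Real.norm_eq_abs, abs_mul, abs_div, abs_pow, abs_of_pos hA, abs_of_pos ht0]
      gcongr
      exact hB _ hw.le
  have hlim : Tendsto (fun t => B ^ 2 / A * t) (𝓝[Ici 0] 0) (𝓝 0) :=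
    ((continuous_const_mul _).tendsto' 0 0 (mul_zero _)).mono_left nhdsWithin_le_nhds
  simpa [ContinuousWithinAt] using
    squeeze_zero_norm' (eventually_nhdsWithin_of_forall hbound) hlim

theorem isRadialMultiplier_const_div (hr : IsDominatingShrinkage p n r r') {A : ℝ} (hA : 0 < A) :
    IsRadialMultiplier (fun t => A / t * r (A / t) * r (A / t))
      (fun t => -(A / t * r (A / t) * r (A / t)
        + 2 * (A / t * r (A / t)) * (A / t * r' (A / t))) / t) where
  measurable := by
    have := hr.measurable
    fun_prop
  measurable_deriv := by
    have := hr.measurable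
    have := hr.measurable_deriv
    fun_prop
  continuousWithinAt_zero := hr.continuousWithinAt_const_div hA
  hasDerivAt t ht := by
    have hw : HasDerivAt (fun t => A / t) (-A / t ^ 2) t := by
      simpa using (hasDerivAt_const t A).fun_div (hasDerivAt_id' t) ht.ne'
    have hrw : HasDerivAt (fun t => r (A / t)) (r' (A / t) * (-A / t ^ 2)) t :=
      (hr.hasDerivAt (A / t) (by positivity)).comp t hw
    refine ((hw.fun_mul hrw).fun_mul hrw).congr_deriv ?_
    field_simp
    ring
  bounded := by
    obtain ⟨C, hC⟩ := hr.exists_abs_mul_mul_sub_le 1 0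
    exact ⟨C, fun t ht => by simpa using hC (A / t) (by positivity)⟩
  bounded_deriv := by
    obtain ⟨C, hC⟩ := hr.exists_abs_mul_mul_sub_le (-1) 2
    refine ⟨C, fun t ht => ?_⟩
    rcases ht.eq_or_lt with rfl | ht0
    · simpa using hC 0 le_rfl
    · rw [mul_div_cancel₀ _ ht0.ne']
      refine (hC (A / t) (by positivity)).trans_eq' ?_
      congr 1
      ring

end IsDominatingShrinkage

/-- The ratio `‖x‖² / ‖z‖²`, on which the amount of shrinkage depends. It is `0` when `z = 0`. -/
noncomputable def sqRatio (y : Euc p × Euc n) : ℝ := ‖y.1‖ ^ 2 / ‖y.2‖ ^ 2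

/-- The squared distance `‖x - θ‖² + ‖z‖²` from `(x, z)` to the centre `(θ, 0)` of the density. -/
noncomputable def sqResidual (θ : Euc p) (y : Euc p × Euc n) : ℝ := ‖y.1 - θ‖ ^ 2 + ‖y.2‖ ^ 2

/-- The estimator that shrinks `x` towards the origin by the factor `1 - r (‖x‖² / ‖z‖²)`. -/
noncomputable def shrinkEst (r : ℝ → ℝ) (y : Euc p × Euc n) : Euc p :=
  (1 - r (sqRatio y)) • y.1

@[fun_prop]
theorem measurable_sqRatio : Measurable (sqRatio : Euc p × Euc n → ℝ) := by
  unfold sqRatio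
  fun_prop

theorem sqRatio_nonneg (y : Euc p × Euc n) : 0 ≤ sqRatio y :=
  div_nonneg (sq_nonneg _) (sq_nonneg _)

@[fun_prop]
theorem continuous_sqResidual (θ : Euc p) :
    Continuous (sqResidual θ : Euc p × Euc n → ℝ) := by
  unfold sqResidual
  fun_prop

theorem measurable_shrinkEst (hr : Measurable r) :
    Measurable (shrinkEst r : Euc p × Euc n → Euc p) := by
  unfold shrinkEst
  fun_prop

theorem norm_le_of_sqResidual_lt {θ : Euc p} {y : Euc p × Euc n} (h : sqResidual θ y < T) :
    ‖y‖ ≤ ‖θ‖ + (T + 1) := by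
  have hfst := norm_le_of_norm_sub_sq_add_lt (sq_nonneg ‖y.2‖) h
  have hsnd : ‖y.2‖ ≤ ‖(0 : Euc n)‖ + (T + 1) :=
    norm_le_of_norm_sub_sq_add_lt (sq_nonneg ‖y.1 - θ‖) (by rwa [sub_zero, add_comm])
  rw [norm_zero, zero_add] at hsnd
  exact max_le hfst (hsnd.trans (le_add_of_nonneg_left (norm_nonneg θ)))

theorem norm_shrinkEst_sub_sq (θ : Euc p) (y : Euc p × Euc n) :
    ‖shrinkEst r y - θ‖ ^ 2 = ‖y.1 - θ‖ ^ 2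
      + (r (sqRatio y) ^ 2 * ‖y.1‖ ^ 2 - 2 * (r (sqRatio y) * inner ℝ y.1 (y.1 - θ))) := by
  rw [shrinkEst, sub_smul, one_smul, sub_right_comm, norm_sub_sq_real, inner_smul_right,
    real_inner_comm, norm_smul, mul_pow, Real.norm_eq_abs, sq_abs]
  ring

theorem ae_ne_zero_of_one_le {d : ℕ} (hd : 1 ≤ d) : ∀ᵐ z : Euc d, z ≠ 0 := by
  have : Nonempty (Fin d) := ⟨⟨0, hd⟩⟩
  have : Nontrivial (Euc d) := inferInstance
  exact Measure.ae_ne volume 0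

theorem integrable_bounded_mul_continuous_mul_sqResidual {h ℓ : Euc p × Euc n → ℝ} {ψ : ℝ → ℝ}
    {C : ℝ} (hh : Measurable h) (hC : ∀ y, |h y| ≤ C) (hℓ : Continuous ℓ) (hψ : Continuous ψ)
    (hψ0 : ∀ t, T ≤ t → ψ t = 0) (θ : Euc p) :
    Integrable fun y => h y * (ℓ y * ψ (sqResidual θ y)) :=
  integrable_bounded_mul_continuous_mul_comp hh hC hℓ hψ hψ0 (by fun_prop)
    fun _ => norm_le_of_sqResidual_lt

namespace IsDominatingShrinkage

theorem integrable_location (hr : IsDominatingShrinkage p n r r') (hf : Continuous f)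
    (hT : ∀ s, T ≤ s → f s = 0) (θ : Euc p) :
    Integrable fun y : Euc p × Euc n =>
      r (sqRatio y) * (inner ℝ y.1 (y.1 - θ) * f (sqResidual θ y)) :=
  integrable_bounded_mul_continuous_mul_sqResidual (hr.measurable.comp (by fun_prop))
    (fun y => hr.abs_le_one (sqRatio_nonneg y)) (by fun_prop) hf hT θ

theorem integrable_location_halfTail (hr : IsDominatingShrinkage p n r r') (hf : Continuous f)
    (hT : ∀ s, T ≤ s → f s = 0) (θ : Euc p) :
    Integrable fun y : Euc p × Euc n =>
      (p * r (sqRatio y) + 2 * (sqRatio y * r' (sqRatio y)))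
        * halfTail f T (sqResidual θ y) := by
  obtain ⟨C, hC⟩ := hr.bounded_deriv
  have hmeas := hr.measurable
  have hmeas' := hr.measurable_deriv
  have hbound : ∀ y : Euc p × Euc n,
      |p * r (sqRatio y) + 2 * (sqRatio y * r' (sqRatio y))| ≤ p * 1 + 2 * C := fun y => by
    refine (abs_add_le _ _).trans ?_
    rw [abs_mul, abs_mul 2, Nat.abs_cast, abs_two]
    gcongr
    exacts [hr.abs_le_one (sqRatio_nonneg y), hC _ (sqRatio_nonneg y)]
  simpa only [one_mul] using integrable_bounded_mul_continuous_mul_sqResidual (ℓ := fun _ => 1)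
    (by fun_prop) hbound continuous_const (continuous_halfTail hf T)
    (fun t => halfTail_eq_zero hT) θ

theorem integrable_residual (hr : IsDominatingShrinkage p n r r') (hf : Continuous f)
    (hT : ∀ s, T ≤ s → f s = 0) (θ : Euc p) :
    Integrable fun y : Euc p × Euc n =>
      r (sqRatio y) ^ 2 * (‖y.1‖ ^ 2 * f (sqResidual θ y)) :=
  integrable_bounded_mul_continuous_mul_sqResidual
    ((hr.measurable.comp (by fun_prop)).pow_const 2)
    (fun y => (abs_pow _ _).trans_le
      (pow_le_one₀ (abs_nonneg _) (hr.abs_le_one (sqRatio_nonneg y)))) (by fun_prop) hf hT θ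

theorem integrable_residual_halfTail (hr : IsDominatingShrinkage p n r r') (hf : Continuous f)
    (hT : ∀ s, T ≤ s → f s = 0) (θ : Euc p) :
    Integrable fun y : Euc p × Euc n =>
      ((n - 2) * (sqRatio y * r (sqRatio y)) * r (sqRatio y)
        - 4 * (sqRatio y * r (sqRatio y)) * (sqRatio y * r' (sqRatio y)))
        * halfTail f T (sqResidual θ y) := by
  obtain ⟨C, hC⟩ := hr.exists_abs_mul_mul_sub_le (n - 2) 4
  have hmeas := hr.measurable
  have hmeas' := hr.measurable_deriv
  simpa only [one_mul] using integrable_bounded_mul_continuous_mul_sqResidual (ℓ := fun _ => 1)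
    (by fun_prop) (fun y => hC _ (sqRatio_nonneg y)) continuous_const (continuous_halfTail hf T)
    (fun t => halfTail_eq_zero hT) θ

/-- Stein's identity in `x`, for each fixed `z ≠ 0`. -/
theorem integral_location (hn : 1 ≤ n) (hr : IsDominatingShrinkage p n r r') (hf : Continuous f)
    (hT : ∀ s, T ≤ s → f s = 0) (θ : Euc p) :
    ∫ y : Euc p × Euc n, r (sqRatio y) * (inner ℝ y.1 (y.1 - θ) * f (sqResidual θ y))
      = ∫ y : Euc p × Euc n, (p * r (sqRatio y) + 2 * (sqRatio y * r' (sqRatio y)))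
          * halfTail f T (sqResidual θ y) := by
  have hint := hr.integrable_location hf hT θ
  have hint' := hr.integrable_location_halfTail hf hT θ
  rw [Measure.volume_eq_prod] at hint hint' ⊢
  rw [integral_prod_symm _ hint, integral_prod_symm _ hint']
  refine integral_congr_ae ?_
  filter_upwards [ae_ne_zero_of_one_le hn] with z hz
  have hstein := (hr.isRadialMultiplier_div_const (s := ‖z‖ ^ 2) (by positivity)).integral_mul_inner
    hf hT (sq_nonneg ‖z‖) θ
  simpa only [sqRatio, sqResidual, ← mul_div_assoc, mul_div_right_comm] using hstein

/-- Stein's identity in `z`, for each fixed `x ≠ 0`. -/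
theorem integral_residual (hp : 1 ≤ p) (hn : 1 ≤ n) (hr : IsDominatingShrinkage p n r r')
    (hf : Continuous f) (hT : ∀ s, T ≤ s → f s = 0) (θ : Euc p) :
    ∫ y : Euc p × Euc n, r (sqRatio y) ^ 2 * (‖y.1‖ ^ 2 * f (sqResidual θ y))
      = ∫ y : Euc p × Euc n, ((n - 2) * (sqRatio y * r (sqRatio y)) * r (sqRatio y)
          - 4 * (sqRatio y * r (sqRatio y)) * (sqRatio y * r' (sqRatio y)))
          * halfTail f T (sqResidual θ y) := by
  have hint := hr.integrable_residual hf hT θ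
  have hint' := hr.integrable_residual_halfTail hf hT θ
  rw [Measure.volume_eq_prod] at hint hint' ⊢
  rw [integral_prod _ hint, integral_prod _ hint']
  refine integral_congr_ae ?_
  filter_upwards [ae_ne_zero_of_one_le hp] with x hx
  have hstein := (hr.isRadialMultiplier_const_div (A := ‖x‖ ^ 2) (by positivity)).integral_mul_inner
    hf hT (sq_nonneg ‖x - θ‖) (0 : Euc n)
  simp only [sub_zero, real_inner_self_eq_norm_sq] at hstein
  refine (integral_congr_ae ?_).trans (hstein.trans (integral_congr_ae ?_))
  all_goals
    filter_upwards [ae_ne_zero_of_one_le hn] with z hz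
    have hz2 : ‖z‖ ^ 2 ≠ 0 := by positivity
    rw [sqRatio, sqResidual, add_comm (‖z‖ ^ 2)]
  · field_simp
  · rw [mul_div_cancel₀ _ hz2]
    ring

theorem lintegral_sq_sub_le_of_continuous (hp : 1 ≤ p) (hn : 1 ≤ n)
    (hr : IsDominatingShrinkage p n r r') (hf : Continuous f) (hf0 : ∀ s, 0 ≤ f s)
    (hT : ∀ s, T ≤ s → f s = 0) (θ : Euc p) :
    ∫⁻ y : Euc p × Euc n, ENNReal.ofReal (‖shrinkEst r y - θ‖ ^ 2 * f (sqResidual θ y))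
      ≤ ∫⁻ y : Euc p × Euc n, ENNReal.ofReal (‖y.1 - θ‖ ^ 2 * f (sqResidual θ y)) := by
  have hX : Integrable fun y : Euc p × Euc n => ‖y.1 - θ‖ ^ 2 * f (sqResidual θ y) := by
    simpa only [one_mul] using integrable_bounded_mul_continuous_mul_sqResidual
      measurable_const (fun _ => abs_one.le) (by fun_prop) hf hT θ
  have hlocation := (hr.integrable_location hf hT θ).const_mul 2
  have hresidual := hr.integrable_residual hf hT θ
  have hexpand : ∀ y : Euc p × Euc n, ‖shrinkEst r y - θ‖ ^ 2 * f (sqResidual θ y)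
      = ‖y.1 - θ‖ ^ 2 * f (sqResidual θ y)
        + (r (sqRatio y) ^ 2 * (‖y.1‖ ^ 2 * f (sqResidual θ y))
          - 2 * (r (sqRatio y) * (inner ℝ y.1 (y.1 - θ) * f (sqResidual θ y)))) := fun y => by
    rw [norm_shrinkEst_sub_sq]
    ring
  have hnonneg (δ : Euc p × Euc n → Euc p) :
      0 ≤ᵐ[volume] fun y => ‖δ y - θ‖ ^ 2 * f (sqResidual θ y) :=
    ae_of_all _ fun y => mul_nonneg (sq_nonneg _) (hf0 _)
  have hdiff := hX.add (hresidual.sub' hlocation)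
  rw [← ofReal_integral_eq_lintegral_ofReal hX (hnonneg Prod.fst),
    ← ofReal_integral_eq_lintegral_ofReal (hdiff.congr (ae_of_all _ fun y => (hexpand y).symm))
      (hnonneg (shrinkEst r))]
  refine ENNReal.ofReal_le_ofReal ?_
  simp only [hexpand]
  rw [integral_add hX (hresidual.sub' hlocation), integral_sub hresidual hlocation,
    integral_const_mul, hr.integral_location hn hf hT θ, hr.integral_residual hp hn hf hT θ,
    ← integral_const_mul, ← integral_sub (hr.integrable_residual_halfTail hf hT θ)
      ((hr.integrable_location_halfTail hf hT θ).const_mul 2), add_le_iff_nonpos_right]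
  refine integral_nonpos fun y => ?_
  have hdiv := mul_nonpos_of_nonpos_of_nonneg (hr.div_nonpos _ (sqRatio_nonneg y))
    (halfTail_nonneg hf0 hT (sqResidual θ y))
  simp only [Pi.zero_apply]
  linarith

end IsDominatingShrinkage

end Domination

section Approximation

theorem measure_le_of_isCompact_of_lintegral_le {X : Type*} [TopologicalSpace X] [T2Space X]
    [LocallyCompactSpace X] [MeasurableSpace X] [BorelSpace X] {μ ν : Measure X} [ν.OuterRegular]
    (h : ∀ φ : C(X, ℝ), (∀ x, 0 ≤ φ x) → HasCompactSupport φ →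
      ∫⁻ x, ENNReal.ofReal (φ x) ∂μ ≤ ∫⁻ x, ENNReal.ofReal (φ x) ∂ν)
    {K : Set X} (hK : IsCompact K) : μ K ≤ ν K := by
  refine le_of_forall_gt fun c hc => ?_
  obtain ⟨U, hKU, hU, hUc⟩ := K.exists_isOpen_lt_of_lt c hc
  obtain ⟨φ, hφ1, hφ0, hφc, hφ01⟩ := exists_continuous_one_zero_of_isCompact hK
    hU.isClosed_compl (disjoint_compl_right_iff_subset.2 hKU)
  have hleft : K.indicator 1 ≤ fun x => ENNReal.ofReal (φ x) :=
    indicator_le fun x hx => by simp [hφ1 hx]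
  have hright : (fun x => ENNReal.ofReal (φ x)) ≤ U.indicator 1 :=
    le_indicator (fun x _ => by simpa using (hφ01 x).2) fun x hx => by simp [hφ0 hx]
  calc μ K = ∫⁻ x, K.indicator 1 x ∂μ := (lintegral_indicator_one hK.measurableSet).symm
    _ ≤ ∫⁻ x, ENNReal.ofReal (φ x) ∂μ := lintegral_mono hleft
    _ ≤ ∫⁻ x, ENNReal.ofReal (φ x) ∂ν := h φ (fun x => (hφ01 x).1) hφc
    _ ≤ ∫⁻ x, U.indicator 1 x ∂ν := lintegral_mono hright
    _ = ν U := lintegral_indicator_one hU.measurableSet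
    _ < c := hUc

theorem measure_le_of_lintegral_le {X : Type*} [TopologicalSpace X] [T2Space X]
    [LocallyCompactSpace X] [SecondCountableTopology X] [MeasurableSpace X] [BorelSpace X]
    {μ ν : Measure X} [IsFiniteMeasureOnCompacts ν]
    (h : ∀ φ : C(X, ℝ), (∀ x, 0 ≤ φ x) → HasCompactSupport φ →
      ∫⁻ x, ENNReal.ofReal (φ x) ∂μ ≤ ∫⁻ x, ENNReal.ofReal (φ x) ∂ν) : μ ≤ ν := by
  have hcompact : ∀ K, IsCompact K → μ K ≤ ν K := fun K =>
    measure_le_of_isCompact_of_lintegral_le h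
  have : IsFiniteMeasureOnCompacts μ := ⟨fun K hK => (hcompact K hK).trans_lt hK.measure_lt_top⟩
  refine Measure.le_iff.2 fun s hs => ?_
  rw [hs.measure_eq_iSup_isCompact]
  exact iSup₂_le fun K hKs => iSup_le fun hK => (hcompact K hK).trans (measure_mono hKs)

theorem lintegral_mul_comp_eq_lintegral_map_withDensity {α β : Type*} [MeasurableSpace α]
    [MeasurableSpace β] {μ : Measure α} {A : α → ℝ≥0∞} {m : α → β} {φ : β → ℝ≥0∞}
    (hA : Measurable A) (hm : Measurable m) (hφ : Measurable φ) :
    ∫⁻ y, A y * φ (m y) ∂μ = ∫⁻ t, φ t ∂((μ.withDensity A).map m) := by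
  rw [lintegral_map hφ hm]
  exact (lintegral_withDensity_eq_lintegral_mul _ hA (hφ.comp hm)).symm

theorem lintegral_mul_comp_le_of_continuous {α : Type*} [MeasurableSpace α] {μ : Measure α}
    {A B : α → ℝ≥0∞} {m : α → ℝ} (hA : Measurable A) (hB : Measurable B)
    (hm : Measurable m) (hfin : ∀ T : ℝ, ∫⁻ y in {y | m y ≤ T}, B y ∂μ < ∞)
    (h : ∀ φ : C(ℝ, ℝ), (∀ s, 0 ≤ φ s) → HasCompactSupport φ →
      ∫⁻ y, A y * ENNReal.ofReal (φ (m y)) ∂μ ≤ ∫⁻ y, B y * ENNReal.ofReal (φ (m y)) ∂μ)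
    {φ : ℝ → ℝ≥0∞} (hφ : Measurable φ) :
    ∫⁻ y, A y * φ (m y) ∂μ ≤ ∫⁻ y, B y * φ (m y) ∂μ := by
  have : IsFiniteMeasureOnCompacts ((μ.withDensity B).map m) := ⟨fun K hK => by
    obtain ⟨T, hT⟩ := hK.bddAbove
    refine (measure_mono (t := Iic T) fun x hx => hT hx).trans_lt ?_
    rw [Measure.map_apply hm measurableSet_Iic, withDensity_apply _ (hm measurableSet_Iic)]
    exact hfin T⟩
  rw [lintegral_mul_comp_eq_lintegral_map_withDensity hA hm hφ,
    lintegral_mul_comp_eq_lintegral_map_withDensity hB hm hφ]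
  refine lintegral_mono' (measure_le_of_lintegral_le fun ψ hψ0 hψc => ?_) le_rfl
  have hψ : Measurable fun t => ENNReal.ofReal (ψ t) := by fun_prop
  rw [← lintegral_mul_comp_eq_lintegral_map_withDensity hA hm hψ,
    ← lintegral_mul_comp_eq_lintegral_map_withDensity hB hm hψ]
  exact h ψ hψ0 hψc

end Approximation

section

variable {p n : ℕ} {r r' : ℝ → ℝ}

theorem volume_sqResidual_le_lt_top (θ : Euc p) (T : ℝ) :
    volume {y : Euc p × Euc n | sqResidual θ y ≤ T} < ∞ := by
  refine (measure_mono (t := Metric.closedBall 0 (‖θ‖ + (T + 1 + 1))) fun y hy => ?_).trans_lt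
    (isCompact_closedBall 0 _).measure_lt_top
  exact mem_closedBall_zero_iff.2 (norm_le_of_sqResidual_lt (lt_add_of_le_of_pos hy one_pos))

theorem IsDominatingShrinkage.lintegral_sq_sub_le (hp : 1 ≤ p) (hn : 1 ≤ n)
    (hr : IsDominatingShrinkage p n r r') {φ : ℝ → ℝ≥0∞} (hφ : Measurable φ) (θ : Euc p) :
    ∫⁻ y : Euc p × Euc n, ENNReal.ofReal (‖shrinkEst r y - θ‖ ^ 2) * φ (sqResidual θ y)
      ≤ ∫⁻ y : Euc p × Euc n, ENNReal.ofReal (‖y.1 - θ‖ ^ 2) * φ (sqResidual θ y) := by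
  have hmeas := measurable_shrinkEst (p := p) (n := n) hr.measurable
  refine lintegral_mul_comp_le_of_continuous (by fun_prop) (by fun_prop) (by fun_prop)
    (fun T => ?_) (fun ψ hψ0 hψc => ?_) hφ
  · refine setLIntegral_lt_top_of_le_nnreal (volume_sqResidual_le_lt_top θ T).ne
      ⟨T.toNNReal, fun y hy => ENNReal.ofReal_le_ofReal ?_⟩
    exact (le_add_of_nonneg_right (sq_nonneg ‖y.2‖)).trans hy
  · obtain ⟨T, hT⟩ := hψc.isCompact.bddAbove
    have hzero : ∀ s, T + 1 ≤ s → ψ s = 0 := fun s hs =>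
      image_eq_zero_of_notMem_tsupport fun hmem => (hT hmem).not_gt (by linarith)
    simpa only [ENNReal.ofReal_mul (sq_nonneg _)] using
      hr.lintegral_sq_sub_le_of_continuous hp hn ψ.continuous hψ0 hzero θ

end

section Symmetrization

variable {E : Type*} [NormedAddCommGroup E] [InnerProductSpace ℝ E] [MeasurableSpace E]
  [BorelSpace E] {μ : Measure E} [μ.IsNegInvariant]

theorem lintegral_norm_sub_sq_mul_of_even (v : E) {w : E → ℝ≥0∞} (hw : Measurable w)
    (heven : ∀ u, w (-u) = w u) :
    ∫⁻ u, ENNReal.ofReal (‖v - u‖ ^ 2) * w u ∂μ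
      = ENNReal.ofReal (‖v‖ ^ 2) * ∫⁻ u, w u ∂μ + ∫⁻ u, ENNReal.ofReal (‖u‖ ^ 2) * w u ∂μ := by
  have hneg : ∫⁻ u, ENNReal.ofReal (‖v - u‖ ^ 2) * w u ∂μ
      = ∫⁻ u, ENNReal.ofReal (‖v + u‖ ^ 2) * w u ∂μ := by
    rw [← lintegral_neg_eq_self fun u => ENNReal.ofReal (‖v - u‖ ^ 2) * w u]
    simp only [sub_neg_eq_add, heven]
  have hparallelogram : ∀ u, ENNReal.ofReal (‖v - u‖ ^ 2) * w u
      + ENNReal.ofReal (‖v + u‖ ^ 2) * w u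
        = 2 * (ENNReal.ofReal (‖v‖ ^ 2) * w u + ENNReal.ofReal (‖u‖ ^ 2) * w u) := fun u => by
    have h : ‖v - u‖ ^ 2 + ‖v + u‖ ^ 2 = 2 * (‖v‖ ^ 2 + ‖u‖ ^ 2) := by
      linarith [parallelogram_law_with_norm ℝ v u, sq ‖v - u‖, sq ‖v + u‖, sq ‖v‖, sq ‖u‖]
    rw [← add_mul, ← add_mul, ← mul_assoc, ← ENNReal.ofReal_add (by positivity) (by positivity),
      ← ENNReal.ofReal_add (by positivity) (by positivity), h, ENNReal.ofReal_mul two_pos.le,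
      ENNReal.ofReal_ofNat]
  have hm : Measurable fun u => ENNReal.ofReal (‖v - u‖ ^ 2) * w u :=
    (by fun_prop : Continuous fun u => ‖v - u‖ ^ 2).measurable.ennreal_ofReal.mul hw
  refine (ENNReal.mul_right_inj two_ne_zero ENNReal.ofNat_ne_top).1 ?_
  calc 2 * ∫⁻ u, ENNReal.ofReal (‖v - u‖ ^ 2) * w u ∂μ
      = ∫⁻ u, ENNReal.ofReal (‖v - u‖ ^ 2) * w u ∂μ
        + ∫⁻ u, ENNReal.ofReal (‖v + u‖ ^ 2) * w u ∂μ := by rw [two_mul, ← hneg]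
    _ = 2 * ∫⁻ u, (ENNReal.ofReal (‖v‖ ^ 2) * w u + ENNReal.ofReal (‖u‖ ^ 2) * w u) ∂μ := by
        rw [← lintegral_add_left hm, lintegral_congr hparallelogram,
          lintegral_const_mul _ (by fun_prop)]
    _ = _ := by rw [lintegral_add_left (by fun_prop), lintegral_const_mul _ hw]

theorem setLIntegral_closedBall_zero_le [μ.IsAddLeftInvariant] (x d : E) (K : ℝ)
    {ψ : ℝ → ℝ≥0∞} (hψ : Measurable ψ) :
    ∫⁻ u in Metric.closedBall 0 K, ENNReal.ofReal (‖u‖ ^ 2) * ψ ‖u‖ ∂μ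
      ≤ ∫⁻ θ in Metric.closedBall x K, ENNReal.ofReal (‖d - θ‖ ^ 2) * ψ ‖x - θ‖ ∂μ := by
  set w : E → ℝ≥0∞ := (Metric.closedBall 0 K).indicator fun u => ψ ‖u‖ with hw
  have hwm : Measurable w := (hψ.comp measurable_norm).indicator measurableSet_closedBall
  have heven : ∀ u, w (-u) = w u := fun u => by simp [hw, indicator]
  calc ∫⁻ u in Metric.closedBall 0 K, ENNReal.ofReal (‖u‖ ^ 2) * ψ ‖u‖ ∂μ
      = ∫⁻ u, ENNReal.ofReal (‖u‖ ^ 2) * w u ∂μ := by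
        rw [← lintegral_indicator measurableSet_closedBall]
        simp only [hw, indicator_mul_right]
    _ ≤ ∫⁻ u, ENNReal.ofReal (‖d - x - u‖ ^ 2) * w u ∂μ :=
        le_add_self.trans_eq (lintegral_norm_sub_sq_mul_of_even (d - x) hwm heven).symm
    _ = ∫⁻ θ in Metric.closedBall x K, ENNReal.ofReal (‖d - θ‖ ^ 2) * ψ ‖x - θ‖ ∂μ := by
        rw [← lintegral_indicator measurableSet_closedBall,
          ← lintegral_add_left_eq_self ((Metric.closedBall x K).indicator _) x]
        simp [hw, indicator, sub_sub]

end Symmetrization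

section ConstantRisk

variable {p n : ℕ} {f : ℝ → ℝ}

/-- The risk of the estimator `x`, which does not depend on the parameters; it is the minimax
risk. -/
noncomputable def constRisk (p n : ℕ) (f : ℝ → ℝ) : ℝ≥0∞ :=
  ∫⁻ y : Euc p × Euc n, ENNReal.ofReal (‖y.1‖ ^ 2 * f (‖y.1‖ ^ 2 + ‖y.2‖ ^ 2))

theorem ofReal_pow_finrank_mul_lintegral_comp_smul {E : Type*} [NormedAddCommGroup E]
    [NormedSpace ℝ E] [MeasurableSpace E] [BorelSpace E] [FiniteDimensional ℝ E] (μ : Measure E)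
    [μ.IsAddHaarMeasure] {c : ℝ} (hc : 0 < c) {G : E → ℝ≥0∞} (hG : Measurable G) :
    ENNReal.ofReal (c ^ Module.finrank ℝ E) * ∫⁻ y, G (c • y) ∂μ = ∫⁻ y, G y ∂μ := by
  have h := lintegral_map (μ := μ) hG (measurable_const_smul c)
  rw [Measure.map_addHaar_smul μ hc.ne', lintegral_smul_measure] at h
  rw [← h, smul_eq_mul, ← mul_assoc, ← ENNReal.ofReal_mul (by positivity),
    abs_of_nonneg (by positivity), mul_inv_cancel₀ (by positivity), ENNReal.ofReal_one, one_mul]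

theorem loss_mul_density_eq (θ : Euc p) {η : ℝ} (hη : 0 < η) (y : Euc p × Euc n) :
    loss y.1 θ η * density f θ η y = √η ^ (p + n) *
      (‖(√η • (y - (θ, 0))).1‖ ^ 2 *
        f (‖(√η • (y - (θ, 0))).1‖ ^ 2 + ‖(√η • (y - (θ, 0))).2‖ ^ 2)) := by
  have hfst : ‖(√η • (y - (θ, (0 : Euc n)))).1‖ ^ 2 = η * ‖y.1 - θ‖ ^ 2 := by
    rw [Prod.smul_fst, Prod.fst_sub, norm_smul, mul_pow, Real.norm_eq_abs, sq_abs,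
      Real.sq_sqrt hη.le]
  have hsnd : ‖(√η • (y - (θ, (0 : Euc n)))).2‖ ^ 2 = η * ‖y.2‖ ^ 2 := by
    rw [Prod.smul_snd, Prod.snd_sub, sub_zero, norm_smul, mul_pow, Real.norm_eq_abs, sq_abs,
      Real.sq_sqrt hη.le]
  have hpow : √η ^ (p + n) = η ^ (((p : ℝ) + n) / 2) := by
    rw [Real.sqrt_eq_rpow, ← Real.rpow_mul_natCast hη.le]
    push_cast
    ring_nf
  rw [hfst, hsnd, hpow, loss, density, ← mul_add]
  ring

theorem risk_fst (hf : Measurable f) (θ : Euc p) {η : ℝ} (hη : 0 < η) :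
    risk f (Prod.fst : Euc p × Euc n → Euc p) θ η = constRisk p n f := by
  have : (volume : Measure (Euc p × Euc n)).IsAddHaarMeasure :=
    inferInstanceAs ((volume : Measure (Euc p)).prod (volume : Measure (Euc n))).IsAddHaarMeasure
  set G : Euc p × Euc n → ℝ≥0∞ :=
    fun y => ENNReal.ofReal (‖y.1‖ ^ 2 * f (‖y.1‖ ^ 2 + ‖y.2‖ ^ 2))
  have hGm : Measurable G := by fun_prop
  calc risk f Prod.fst θ η
      = ∫⁻ y, ENNReal.ofReal (√η ^ (p + n)) * G (√η • (y - (θ, 0))) :=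
        lintegral_congr fun y => by
          rw [loss_mul_density_eq θ hη, ENNReal.ofReal_mul (by positivity)]
    _ = ENNReal.ofReal (√η ^ (p + n)) * ∫⁻ y, G (√η • y) := by
        rw [lintegral_const_mul _ (by fun_prop),
          lintegral_sub_right_eq_self (fun y => G (√η • y)) (θ, 0)]
    _ = constRisk p n f := by
        have := ofReal_pow_finrank_mul_lintegral_comp_smul volume (Real.sqrt_pos.2 hη) hGm
        rwa [Module.finrank_prod, finrank_euclideanSpace_fin, finrank_euclideanSpace_fin] at this

theorem IsDominatingShrinkage.risk_le {r r' : ℝ → ℝ} (hp : 1 ≤ p) (hn : 1 ≤ n)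
    (hr : IsDominatingShrinkage p n r r') (hf : Measurable f) (θ : Euc p) {η : ℝ} (hη : 0 < η) :
    risk f (shrinkEst r : Euc p × Euc n → Euc p) θ η ≤ constRisk p n f := by
  set φ : ℝ → ℝ≥0∞ := fun t => ENNReal.ofReal (η * (η ^ (((p : ℝ) + n) / 2) * f (η * t))) with hφ
  have hrisk : ∀ δ : Euc p × Euc n → Euc p,
      risk f δ θ η = ∫⁻ y, ENNReal.ofReal (‖δ y - θ‖ ^ 2) * φ (sqResidual θ y) := fun δ =>
    lintegral_congr fun y => by
      rw [hφ, ← ENNReal.ofReal_mul (sq_nonneg _), loss, density, sqResidual]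
      ring_nf
  rw [← risk_fst hf θ hη, hrisk, hrisk]
  exact hr.lintegral_sq_sub_le hp hn (by fun_prop) θ

/-- The part of `constRisk` carried by `‖x‖ ≤ K`. -/
noncomputable def truncRisk (p n : ℕ) (f : ℝ → ℝ) (K : ℝ) : ℝ≥0∞ :=
  ∫⁻ y : Euc p × Euc n in Metric.closedBall 0 K ×ˢ univ,
    ENNReal.ofReal (‖y.1‖ ^ 2 * f (‖y.1‖ ^ 2 + ‖y.2‖ ^ 2))

theorem iSup_truncRisk : ⨆ K : ℕ, truncRisk p n f K = constRisk p n f := by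
  have hmono : Monotone fun K : ℕ => Metric.closedBall (0 : Euc p) K ×ˢ (univ : Set (Euc n)) :=
    fun K L hKL => prod_mono_left (Metric.closedBall_subset_closedBall (Nat.cast_le.2 hKL))
  rw [constRisk, ← setLIntegral_univ, ← univ_prod_univ, ← Metric.iUnion_closedBall_nat (0 : Euc p),
    iUnion_prod_const, setLIntegral_iUnion_of_directed _ hmono.directed_le]
  rfl

theorem truncRisk_eq_lintegral (hf : Measurable f) (K : ℝ) :
    truncRisk p n f K = ∫⁻ z : Euc n, ∫⁻ u in Metric.closedBall (0 : Euc p) K,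
      ENNReal.ofReal (‖u‖ ^ 2) * ENNReal.ofReal (f (‖u‖ ^ 2 + ‖z‖ ^ 2)) := by
  rw [truncRisk, Measure.volume_eq_prod, ← Measure.prod_restrict, Measure.restrict_univ,
    lintegral_prod_symm _ (by fun_prop)]
  simp only [ENNReal.ofReal_mul (sq_nonneg _)]

theorem risk_one (δ : Euc p × Euc n → Euc p) (θ : Euc p) :
    risk f δ θ 1 = ∫⁻ y, ENNReal.ofReal (‖δ y - θ‖ ^ 2) * ENNReal.ofReal (f (sqResidual θ y)) :=
  lintegral_congr fun y => by
    rw [loss, density, sqResidual, one_mul, one_mul, Real.one_rpow, one_mul,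
      ENNReal.ofReal_mul (sq_nonneg _)]

theorem risk_le_maxRisk (δ : Euc p × Euc n → Euc p) (θ : Euc p) {η : ℝ} (hη : 0 < η) :
    risk f δ θ η ≤ maxRisk f δ :=
  le_iSup_of_le θ (le_iSup₂_of_le η hη le_rfl)

theorem volume_closedBall_mul_truncRisk_le (hf : Measurable f) {δ : Euc p × Euc n → Euc p}
    (hδ : Measurable δ) (R K : ℝ) :
    volume (Metric.closedBall (0 : Euc p) R) * truncRisk p n f K
      ≤ maxRisk f δ * volume (Metric.closedBall (0 : Euc p) (R + K)) := by
  set B : Set (Euc p) := Metric.closedBall 0 (R + K)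
  set H : Euc p → Euc p × Euc n → ℝ≥0∞ := fun θ y =>
    ENNReal.ofReal (‖δ y - θ‖ ^ 2) * ENNReal.ofReal (f (‖y.1 - θ‖ ^ 2 + ‖y.2‖ ^ 2)) with hH
  have hHm : Measurable (Function.uncurry H) := by
    simp only [hH, Function.uncurry_def]
    fun_prop
  have hfiber : ∀ x ∈ Metric.closedBall (0 : Euc p) R,
      truncRisk p n f K ≤ ∫⁻ z : Euc n, ∫⁻ θ in B, H θ (x, z) := fun x hx => by
    rw [truncRisk_eq_lintegral hf]
    refine lintegral_mono fun z => (setLIntegral_closedBall_zero_le x (δ (x, z)) K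
      (ψ := fun t => ENNReal.ofReal (f (t ^ 2 + ‖z‖ ^ 2))) (by fun_prop)).trans ?_
    refine lintegral_mono_set (Metric.closedBall_subset_closedBall' ?_)
    linarith [Metric.mem_closedBall.1 hx]
  calc volume (Metric.closedBall (0 : Euc p) R) * truncRisk p n f K
      = ∫⁻ _ in Metric.closedBall (0 : Euc p) R, truncRisk p n f K := by
        rw [setLIntegral_const, mul_comm]
    _ ≤ ∫⁻ x in Metric.closedBall (0 : Euc p) R, ∫⁻ z : Euc n, ∫⁻ θ in B, H θ (x, z) :=
        setLIntegral_mono' measurableSet_closedBall hfiber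
    _ ≤ ∫⁻ x, ∫⁻ z : Euc n, ∫⁻ θ in B, H θ (x, z) := setLIntegral_le_lintegral _ _
    _ = ∫⁻ θ in B, ∫⁻ y, H θ y := by
        rw [lintegral_lintegral_swap hHm.aemeasurable, Measure.volume_eq_prod,
          lintegral_prod _ (by exact (hHm.comp measurable_swap).lintegral_prod_right'.aemeasurable)]
    _ ≤ ∫⁻ _ in B, maxRisk f δ :=
        lintegral_mono fun θ => (risk_one δ θ).symm.trans_le (risk_le_maxRisk δ θ one_pos)
    _ = maxRisk f δ * volume B := setLIntegral_const _ _

theorem truncRisk_le_maxRisk (hf : Measurable f) {δ : Euc p × Euc n → Euc p} (hδ : Measurable δ)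
    {K : ℝ} (hK : 0 ≤ K) : truncRisk p n f K ≤ maxRisk f δ := by
  have hlim : Tendsto (fun R : ℝ => maxRisk f δ * ENNReal.ofReal ((1 + K / R) ^ p)) atTop
      (𝓝 (maxRisk f δ)) := by
    have hratio : Tendsto (fun R : ℝ => (1 + K / R) ^ p) atTop (𝓝 1) := by
      simpa using ((tendsto_id.const_div_atTop K).const_add 1).pow p
    simpa using ENNReal.Tendsto.const_mul (a := maxRisk f δ) (ENNReal.tendsto_ofReal hratio)
      (Or.inl (by simp))
  refine ge_of_tendsto hlim ?_
  filter_upwards [eventually_gt_atTop 0] with R hR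
  have hvol : volume (Metric.closedBall (0 : Euc p) (R + K))
      = ENNReal.ofReal ((1 + K / R) ^ p) * volume (Metric.closedBall (0 : Euc p) R) := by
    have hRK : R + K = (1 + K / R) * R := by field_simp
    have hnn : 0 ≤ 1 + K / R := by positivity
    rw [hRK, Measure.addHaar_closedBall_mul _ _ hnn hR.le, finrank_euclideanSpace_fin]
  have h := volume_closedBall_mul_truncRisk_le hf hδ R K
  rw [hvol, ← mul_assoc, mul_comm] at h
  exact (ENNReal.mul_le_mul_iff_left (Metric.measure_closedBall_pos _ _ hR).ne'
    measure_closedBall_lt_top.ne).1 h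

theorem constRisk_le_maxRisk (hf : Measurable f) {δ : Euc p × Euc n → Euc p} (hδ : Measurable δ) :
    constRisk p n f ≤ maxRisk f δ :=
  iSup_truncRisk.symm.trans_le (iSup_le fun K => truncRisk_le_maxRisk hf hδ K.cast_nonneg)

theorem IsDominatingShrinkage.isMinimax {r r' : ℝ → ℝ} (hp : 1 ≤ p) (hn : 1 ≤ n)
    (hr : IsDominatingShrinkage p n r r') (hf : Measurable f) {δ : Euc p × Euc n → Euc p}
    (hδ : Measurable δ)
    (h : ∀ x : Euc p, ∀ z : Euc n, z ≠ 0 → δ (x, z) = shrinkEst r (x, z)) : IsMinimax f δ := by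
  refine ⟨hδ, fun δ' hδ' => le_trans ?_ (constRisk_le_maxRisk hf hδ')⟩
  refine iSup_le fun θ => iSup₂_le fun η hη => le_of_eq_of_le ?_ (hr.risk_le hp hn hf θ hη)
  refine lintegral_congr_ae ?_
  filter_upwards [Measure.quasiMeasurePreserving_snd.ae (ae_ne_zero_of_one_le hn)] with y hy
  rw [h y.1 y.2 hy]

end ConstantRisk

section QuadraticAbout

variable {E : Type*} [NormedAddCommGroup E]

/-- `F d` is the squared distance from `d` to `v`, up to a finite nonzero factor and a finite
additive constant. The expected quadratic loss of the decision `d` has this form, `v` being the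
mean. -/
def IsQuadraticAbout (F : E → ℝ≥0∞) (v : E) : Prop :=
  ∃ A K : ℝ≥0∞, A ≠ 0 ∧ A ≠ ∞ ∧ K ≠ ∞ ∧ ∀ d, F d = A * ENNReal.ofReal (‖d - v‖ ^ 2) + K

variable {F G : E → ℝ≥0∞} {v w : E}

theorem IsQuadraticAbout.of_eq_mul_add (hF : IsQuadraticAbout F v) {c K : ℝ≥0∞} (hc0 : c ≠ 0)
    (hc : c ≠ ∞) (hK : K ≠ ∞) (hG : ∀ d, G d = c * F d + K) : IsQuadraticAbout G v := by
  obtain ⟨A, L, hA0, hA, hL, hF⟩ := hF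
  refine ⟨c * A, c * L + K, mul_ne_zero hc0 hA0, ENNReal.mul_ne_top hc hA,
    ENNReal.add_ne_top.2 ⟨ENNReal.mul_ne_top hc hL, hK⟩, fun d => ?_⟩
  rw [hG, hF, mul_add, mul_assoc, add_assoc]

theorem IsQuadraticAbout.ne_top (hF : IsQuadraticAbout F v) (d : E) : F d ≠ ∞ := by
  obtain ⟨A, K, -, hA, hK, hF⟩ := hF
  rw [hF]
  exact ENNReal.add_ne_top.2 ⟨ENNReal.mul_ne_top hA ENNReal.ofReal_ne_top, hK⟩

theorem IsQuadraticAbout.lt (hF : IsQuadraticAbout F v) {d : E} (hd : d ≠ v) : F v < F d := by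
  obtain ⟨A, K, hA0, -, hK, hF⟩ := hF
  have hdist : 0 < ‖d - v‖ := norm_pos_iff.2 (sub_ne_zero.2 hd)
  rw [hF, hF, sub_self, norm_zero, zero_pow two_ne_zero, ENNReal.ofReal_zero, mul_zero, zero_add,
    add_comm]
  exact ENNReal.lt_add_right hK (mul_ne_zero hA0 (by positivity))

theorem IsQuadraticAbout.unique (hv : IsQuadraticAbout F v) (hw : IsQuadraticAbout F w) :
    v = w := by
  by_contra hne
  exact lt_asymm (hv.lt (Ne.symm hne)) (hw.lt hne)

variable {Ω : Type*} [MeasurableSpace Ω] {ω : Measure Ω} {X : Ω → E}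

theorem IsQuadraticAbout.isFiniteMeasure [Nontrivial E] (hX : AEStronglyMeasurable X ω)
    (h : IsQuadraticAbout (fun d => ∫⁻ q, ENNReal.ofReal (‖d - X q‖ ^ 2) ∂ω) v) :
    IsFiniteMeasure ω := by
  obtain ⟨d, hd⟩ := exists_ne (0 : E)
  have hle : ∀ q, ENNReal.ofReal (‖d‖ ^ 2)
      ≤ 2 * (ENNReal.ofReal (‖d - X q‖ ^ 2) + ENNReal.ofReal (‖0 - X q‖ ^ 2)) := fun q => by
    have htri : ‖d‖ ≤ ‖d - X q‖ + ‖0 - X q‖ := by simpa using norm_sub_le (d - X q) (0 - X q)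
    rw [← ENNReal.ofReal_add (by positivity) (by positivity), ← ENNReal.ofReal_ofNat 2,
      ← ENNReal.ofReal_mul two_pos.le]
    refine ENNReal.ofReal_le_ofReal ((pow_le_pow_left₀ (norm_nonneg _) htri 2).trans ?_)
    nlinarith [sq_nonneg (‖d - X q‖ - ‖0 - X q‖)]
  have hdist : ∀ c, AEMeasurable (fun q => ENNReal.ofReal (‖c - X q‖ ^ 2)) ω := fun c =>
    ((aestronglyMeasurable_const.sub hX).norm.aemeasurable.pow_const 2).ennreal_ofReal
  have hmul : ENNReal.ofReal (‖d‖ ^ 2) * ω univ < ∞ := by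
    rw [← lintegral_const]
    refine (lintegral_mono hle).trans_lt ?_
    rw [lintegral_const_mul' _ _ ENNReal.ofNat_ne_top, lintegral_add_left' (hdist d)]
    exact ENNReal.mul_lt_top ENNReal.ofNat_lt_top
      (ENNReal.add_lt_top.2 ⟨(h.ne_top d).lt_top, (h.ne_top 0).lt_top⟩)
  exact ⟨ENNReal.lt_top_of_mul_ne_top_right hmul.ne (by simpa using norm_pos_iff.2 hd |>.ne')⟩

end QuadraticAbout

section Mean

variable {E : Type*} [NormedAddCommGroup E] [InnerProductSpace ℝ E] [CompleteSpace E]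
  {Ω : Type*} [MeasurableSpace Ω] {ω : Measure Ω} {X : Ω → E}

theorem integral_norm_sub_sq [IsFiniteMeasure ω] (hX : MemLp X 2 ω) (d : E) :
    ∫ q, ‖d - X q‖ ^ 2 ∂ω = ω.real univ * ‖d - ⨍ q, X q ∂ω‖ ^ 2
      + ∫ q, ‖X q - ⨍ q, X q ∂ω‖ ^ 2 ∂ω := by
  set c : E := ⨍ q, X q ∂ω
  have hdev : MemLp (fun q => X q - c) 2 ω := hX.sub (memLp_const c)
  have hcross : Integrable (fun q => 2 * inner ℝ (d - c) (X q - c)) ω :=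
    ((hdev.integrable one_le_two).const_inner (d - c)).const_mul 2
  have hexpand : ∀ q, ‖d - X q‖ ^ 2
      = ‖d - c‖ ^ 2 - 2 * inner ℝ (d - c) (X q - c) + ‖X q - c‖ ^ 2 := fun q => by
    rw [← norm_sub_sq_real, sub_sub_sub_cancel_right]
  simp only [hexpand]
  rw [integral_add ((integrable_const _).sub' hcross) hdev.norm.integrable_sq,
    integral_sub (integrable_const _) hcross, integral_const, integral_const_mul,
    integral_inner (hdev.integrable one_le_two), integral_sub_average, inner_zero_right,
    mul_zero, sub_zero, smul_eq_mul]

theorem isQuadraticAbout_average [IsFiniteMeasure ω] [NeZero ω] (hX : MemLp X 2 ω) :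
    IsQuadraticAbout (fun d => ∫⁻ q, ENNReal.ofReal (‖d - X q‖ ^ 2) ∂ω) (⨍ q, X q ∂ω) := by
  have hint : ∀ d : E, Integrable (fun q => ‖d - X q‖ ^ 2) ω := fun d =>
    ((memLp_const d).sub hX).norm.integrable_sq
  refine ⟨ω univ, ENNReal.ofReal (∫ q, ‖X q - ⨍ q, X q ∂ω‖ ^ 2 ∂ω), NeZero.ne _,
    measure_ne_top _ _, ENNReal.ofReal_ne_top, fun d => ?_⟩
  beta_reduce
  rw [← ofReal_integral_eq_lintegral_ofReal (hint d) (ae_of_all _ fun q => sq_nonneg _),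
    integral_norm_sub_sq hX, ENNReal.ofReal_add (by positivity) (by positivity),
    ENNReal.ofReal_mul measureReal_nonneg, ofReal_measureReal]

theorem IsQuadraticAbout.average_eq {v : E} (hX : AEStronglyMeasurable X ω)
    (h : IsQuadraticAbout (fun d => ∫⁻ q, ENNReal.ofReal (‖d - X q‖ ^ 2) ∂ω) v) :
    ⨍ q, X q ∂ω = v := by
  rcases subsingleton_or_nontrivial E with _ | _
  · exact Subsingleton.elim _ _
  have := h.isFiniteMeasure hX
  have : NeZero ω := ⟨by
    rintro rfl
    obtain ⟨d, hd⟩ := exists_ne v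
    simpa using h.lt hd⟩
  have hmem : MemLp X 2 ω := by
    refine (memLp_two_iff_integrable_sq_norm hX).2 ⟨(hX.norm.pow 2), ?_⟩
    rw [hasFiniteIntegral_iff_ofReal (ae_of_all _ fun q => sq_nonneg _)]
    simpa using (h.ne_top 0).lt_top
  exact (isQuadraticAbout_average hmem).unique h

theorem average_withDensity_ofReal {F : Type*} [NormedAddCommGroup F] [NormedSpace ℝ F]
    {μ : Measure Ω} {w : Ω → ℝ} (hw : Measurable w) (hw0 : ∀ᵐ q ∂μ, 0 ≤ w q) (X : Ω → F) :
    ⨍ q, X q ∂(μ.withDensity fun q => ENNReal.ofReal (w q))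
      = (∫ q, w q ∂μ)⁻¹ • ∫ q, w q • X q ∂μ := by
  rw [average_eq, measureReal_def, withDensity_apply _ MeasurableSet.univ, setLIntegral_univ,
    ← integral_eq_lintegral_of_nonneg_ae hw0 hw.aestronglyMeasurable,
    integral_withDensity_eq_integral_toReal_smul hw.ennreal_ofReal
      (ae_of_all _ fun _ => ENNReal.ofReal_lt_top)]
  congr 1
  refine integral_congr_ae ?_
  filter_upwards [hw0] with q hq
  rw [ENNReal.toReal_ofReal hq]

end Mean

section Feynman

variable {A R k m : ℝ}

/-- The projective change of variable of `(0, 1)` behind Feynman's parametrization of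
`A ^ (-k) * R ^ (-m)`. -/
noncomputable def projChange (A R t : ℝ) : ℝ := t * A / (t * A + (1 - t) * R)

theorem combo_pos (hA : 0 < A) (hR : 0 < R) {t : ℝ} (ht : t ∈ Ioo (0 : ℝ) 1) :
    0 < t * A + (1 - t) * R :=
  add_pos (mul_pos ht.1 hA) (mul_pos (sub_pos.2 ht.2) hR)

theorem one_sub_projChange (hA : 0 < A) (hR : 0 < R) {t : ℝ} (ht : t ∈ Ioo (0 : ℝ) 1) :
    1 - projChange A R t = (1 - t) * R / (t * A + (1 - t) * R) := by
  rw [projChange, one_sub_div (combo_pos hA hR ht).ne', add_sub_cancel_left]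

theorem mapsTo_projChange (hA : 0 < A) (hR : 0 < R) :
    MapsTo (projChange A R) (Ioo 0 1) (Ioo 0 1) := fun t ht => by
  have hpos := combo_pos hA hR ht
  refine ⟨div_pos (mul_pos ht.1 hA) hpos, sub_pos.1 ?_⟩
  rw [one_sub_projChange hA hR ht]
  exact div_pos (mul_pos (sub_pos.2 ht.2) hR) hpos

theorem leftInvOn_projChange (hA : 0 < A) (hR : 0 < R) :
    LeftInvOn (projChange R A) (projChange A R) (Ioo 0 1) := fun t ht => by
  have hpos := combo_pos hA hR ht
  rw [projChange, one_sub_projChange hA hR ht, projChange]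
  field_simp
  ring

theorem bijOn_projChange (hA : 0 < A) (hR : 0 < R) :
    BijOn (projChange A R) (Ioo 0 1) (Ioo 0 1) :=
  InvOn.bijOn ⟨leftInvOn_projChange hA hR, leftInvOn_projChange hR hA⟩ (mapsTo_projChange hA hR)
    (mapsTo_projChange hR hA)

theorem hasDerivAt_projChange (hA : 0 < A) (hR : 0 < R) {t : ℝ} (ht : t ∈ Ioo (0 : ℝ) 1) :
    HasDerivAt (projChange A R) (A * R / (t * A + (1 - t) * R) ^ 2) t := by
  have hnum : HasDerivAt (fun t : ℝ => t * A) A t := hasDerivAt_mul_const A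
  have hden : HasDerivAt (fun t : ℝ => t * A + (1 - t) * R) (A + -R) t := by
    simpa using hnum.fun_add (((hasDerivAt_id t).const_sub 1).mul_const R)
  convert! hnum.fun_div hden (combo_pos hA hR ht).ne' using 1
  ring

theorem betaWeight_projChange (hA : 0 < A) (hR : 0 < R) {t : ℝ} (ht : t ∈ Ioo (0 : ℝ) 1) :
    A * R / (t * A + (1 - t) * R) ^ 2 * betaWeight k (m - 1) (projChange A R t)
      = A ^ k * R ^ m * (betaWeight k (m - 1) t * (t * A + (1 - t) * R) ^ (-(k + m))) := by
  have hpos := combo_pos hA hR ht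
  have ht1 : 0 < 1 - t := sub_pos.2 ht.2
  have ht0 := ht.1
  rw [betaWeight, betaWeight, one_sub_projChange hA hR ht, projChange,
    Real.div_rpow (by positivity) hpos.le, Real.div_rpow (by positivity) hpos.le,
    Real.mul_rpow ht0.le hA.le, Real.mul_rpow ht1.le hR.le, Real.rpow_neg hpos.le,
    Real.rpow_add hpos, Real.rpow_sub_one hA.ne', Real.rpow_sub_one hR.ne',
    Real.rpow_sub_one hpos.ne', Real.rpow_sub_one hpos.ne']
  field_simp

theorem lintegral_betaWeight_mul_rpow_neg (hA : 0 < A) (hR : 0 < R) :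
    ∫⁻ t in Ioo (0 : ℝ) 1,
        ENNReal.ofReal (betaWeight k (m - 1) t * (t * A + (1 - t) * R) ^ (-(k + m)))
      = ENNReal.ofReal (A ^ (-k) * R ^ (-m))
        * ∫⁻ t in Ioo (0 : ℝ) 1, ENNReal.ofReal (betaWeight k (m - 1) t) := by
  have hbij := bijOn_projChange hA hR
  conv_rhs => rw [← hbij.image_eq]
  rw [lintegral_image_eq_lintegral_abs_deriv_mul measurableSet_Ioo
      (fun t ht => (hasDerivAt_projChange hA hR ht).hasDerivWithinAt) hbij.injOn,
    ← lintegral_const_mul' _ _ ENNReal.ofReal_ne_top]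
  refine setLIntegral_congr_fun measurableSet_Ioo fun t ht => ?_
  have hcancel : A ^ (-k) * R ^ (-m) * (A ^ k * R ^ m) = 1 := by
    rw [mul_mul_mul_comm, ← Real.rpow_add hA, ← Real.rpow_add hR, neg_add_cancel, neg_add_cancel,
      Real.rpow_zero, Real.rpow_zero, one_mul]
  rw [abs_of_nonneg (by positivity), ← ENNReal.ofReal_mul (by positivity),
    betaWeight_projChange hA hR ht, ← ENNReal.ofReal_mul (by positivity), ← mul_assoc, hcancel,
    one_mul]

end Feynman

section StudentKernel

variable {E : Type*} [NormedAddCommGroup E] [MeasurableSpace E] [BorelSpace E] {μ : Measure E}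
  [μ.IsAddHaarMeasure] {j : ℕ} {M S : ℝ}

/-- The `j`-th absolute moment of the (unnormalized) multivariate Student density
`(1 + ‖u‖²) ^ (-M)`. -/
noncomputable def studentMoment (μ : Measure E) (j : ℕ) (M : ℝ) : ℝ≥0∞ :=
  ∫⁻ u, ENNReal.ofReal (‖u‖ ^ j * (1 + ‖u‖ ^ 2) ^ (-M)) ∂μ

theorem studentMoment_zero_ne_zero : studentMoment μ 0 M ≠ 0 := by
  refine ((lintegral_pos_iff_support (by fun_prop)).2 ?_).ne'
  have hsupp : Function.support
      (fun u : E => ENNReal.ofReal (‖u‖ ^ 0 * (1 + ‖u‖ ^ 2) ^ (-M))) = univ :=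
    Function.support_eq_univ fun u => (ENNReal.ofReal_pos.2 (by positivity)).ne'
  rw [hsupp]
  exact NeZero.pos (μ univ)

section NormedSpace

variable [NormedSpace ℝ E] [FiniteDimensional ℝ E]

theorem studentMoment_ne_top (h : (finrank ℝ E : ℝ) + j < 2 * M) : studentMoment μ j M ≠ ∞ := by
  have hint : Integrable (fun u : E => (1 + ‖u‖ ^ 2) ^ (-(2 * M - j) / 2)) μ :=
    integrable_rpow_neg_one_add_norm_sq (by linarith)
  refine ((lintegral_mono fun u => ENNReal.ofReal_le_ofReal ?_).trans_lt
    hint.lintegral_lt_top).ne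
  have hpow : ‖u‖ ^ j ≤ (1 + ‖u‖ ^ 2) ^ ((j : ℝ) / 2) := by
    rw [div_eq_inv_mul, Real.rpow_mul (by positivity), Real.rpow_natCast, ← one_div,
      ← Real.sqrt_eq_rpow]
    exact pow_le_pow_left₀ (norm_nonneg u) (Real.le_sqrt_of_sq_le (by linarith)) j
  calc ‖u‖ ^ j * (1 + ‖u‖ ^ 2) ^ (-M)
      ≤ (1 + ‖u‖ ^ 2) ^ ((j : ℝ) / 2) * (1 + ‖u‖ ^ 2) ^ (-M) := by gcongr
    _ = (1 + ‖u‖ ^ 2) ^ (-(2 * M - j) / 2) := by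
      rw [← Real.rpow_add (by positivity)]; ring_nf

theorem lintegral_norm_pow_mul_student (hS : 0 < S) :
    ∫⁻ u, ENNReal.ofReal (‖u‖ ^ j * (S + ‖u‖ ^ 2) ^ (-M)) ∂μ
      = ENNReal.ofReal (S ^ (((finrank ℝ E : ℝ) + j) / 2 - M)) * studentMoment μ j M := by
  have hpt : ∀ u : E, ‖√S • u‖ ^ j * (S + ‖√S • u‖ ^ 2) ^ (-M)
      = √S ^ j * S ^ (-M) * (‖u‖ ^ j * (1 + ‖u‖ ^ 2) ^ (-M)) := fun u => by
    have hbase : S + (√S * ‖u‖) ^ 2 = S * (1 + ‖u‖ ^ 2) := by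
      rw [mul_pow, Real.sq_sqrt hS.le]; ring
    rw [norm_smul, Real.norm_of_nonneg (Real.sqrt_nonneg S), hbase,
      Real.mul_rpow hS.le (by positivity)]
    ring
  have hpow : √S ^ finrank ℝ E * (√S ^ j * S ^ (-M))
      = S ^ (((finrank ℝ E : ℝ) + j) / 2 - M) := by
    rw [← mul_assoc, ← pow_add, Real.sqrt_eq_rpow, ← Real.rpow_natCast, ← Real.rpow_mul hS.le,
      ← Real.rpow_add hS]
    push_cast
    ring_nf
  rw [← ofReal_pow_finrank_mul_lintegral_comp_smul μ (Real.sqrt_pos.2 hS) (by fun_prop),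
    ← hpow, ENNReal.ofReal_mul (by positivity), mul_assoc, studentMoment]
  simp only [hpt, ENNReal.ofReal_mul (show 0 ≤ √S ^ j * S ^ (-M) by positivity)]
  rw [lintegral_const_mul' _ _ ENNReal.ofReal_ne_top]

end NormedSpace

theorem lintegral_norm_sub_sq_mul_student [InnerProductSpace ℝ E] [FiniteDimensional ℝ E]
    (hS : 0 < S) (c d : E) :
    ∫⁻ θ, ENNReal.ofReal (‖d - θ‖ ^ 2) * ENNReal.ofReal ((S + ‖θ - c‖ ^ 2) ^ (-M)) ∂μ
      = ENNReal.ofReal (‖d - c‖ ^ 2)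
          * (ENNReal.ofReal (S ^ ((finrank ℝ E : ℝ) / 2 - M)) * studentMoment μ 0 M)
        + ENNReal.ofReal (S ^ ((finrank ℝ E : ℝ) / 2 + 1 - M)) * studentMoment μ 2 M := by
  have hzero := lintegral_norm_pow_mul_student (μ := μ) (j := 0) (M := M) hS
  have htwo := lintegral_norm_pow_mul_student (μ := μ) (j := 2) (M := M) hS
  simp only [pow_zero, one_mul, Nat.cast_zero, add_zero, Nat.cast_ofNat, add_div,
    div_self (two_ne_zero (α := ℝ)), ENNReal.ofReal_mul (sq_nonneg ‖_‖)] at hzero htwo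
  rw [← lintegral_add_right_eq_self
    (fun θ => ENNReal.ofReal (‖d - θ‖ ^ 2) * ENNReal.ofReal ((S + ‖θ - c‖ ^ 2) ^ (-M))) c]
  simp only [add_sub_cancel_right, sub_add_eq_sub_sub_swap]
  rw [lintegral_norm_sub_sq_mul_of_even (d - c) (by fun_prop) fun u => by rw [norm_neg], hzero,
    htwo]

end StudentKernel

section BetaMixture

variable {k b N w : ℝ}

theorem lintegral_betaWeight_mul_rpow (hk : 0 < k) (hb : -1 < b) (hw : -1 < w) :
    ∫⁻ t in Ioo (0 : ℝ) 1, ENNReal.ofReal (betaWeight k b t * (1 + w * t) ^ (-N))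
      = ENNReal.ofReal (betaInt k b N w) :=
  (ofReal_integral_eq_lintegral_ofReal (integrableOn_betaInt hk hb hw)
    (ae_restrict_of_forall_mem measurableSet_Ioo fun _ ht =>
      (mul_pos (betaWeight_pos ht)
        (Real.rpow_pos_of_pos (one_add_mul_pos hw (Ioo_subset_Icc_self ht)) _)).le)).symm

theorem lintegral_betaWeight (hk : 0 < k) (hb : -1 < b) :
    ∫⁻ t in Ioo (0 : ℝ) 1, ENNReal.ofReal (betaWeight k b t)
      = ENNReal.ofReal (betaInt k b 0 0) := by
  rw [← lintegral_betaWeight_mul_rpow hk hb (by norm_num)]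
  simp only [neg_zero, Real.rpow_zero, mul_one]

variable {E : Type*} [NormedAddCommGroup E] [InnerProductSpace ℝ E] [CompleteSpace E]

theorem integral_betaWeight_smul_one_sub_smul (hk : 0 < k) (hb : -1 < b) (hw : -1 < w) (x : E) :
    ∫ t in Ioo (0 : ℝ) 1, (betaWeight k b t * (1 + w * t) ^ (-N)) • ((1 - t) • x)
      = (betaInt k b N w - betaInt (k + 1) b N w) • x := by
  rw [betaInt, betaInt, ← integral_sub (integrableOn_betaInt hk hb hw)
    (integrableOn_betaInt (by linarith) hb hw), ← integral_smul_const]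
  refine setIntegral_congr_fun measurableSet_Ioo fun t ht => ?_
  simp only [smul_smul, betaWeight_add_one_left ht]
  ring_nf

theorem isQuadraticAbout_betaMixture (hk : 0 < k) (hb : -1 < b) (hw : -1 < w) (x : E) :
    IsQuadraticAbout (fun d => ∫⁻ t in Ioo (0 : ℝ) 1,
        ENNReal.ofReal (betaWeight k b t * (1 + w * t) ^ (-N)) *
          ENNReal.ofReal (‖d - (1 - t) • x‖ ^ 2))
      ((1 - shrink k b N w) • x) := by
  set ω : Measure ℝ := (volume.restrict (Ioo 0 1)).withDensity fun t =>
    ENNReal.ofReal (betaWeight k b t * (1 + w * t) ^ (-N)) with hω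
  have hmass : ω univ = ENNReal.ofReal (betaInt k b N w) := by
    rw [hω, withDensity_apply _ MeasurableSet.univ, Measure.restrict_univ,
      lintegral_betaWeight_mul_rpow hk hb hw]
  have : IsFiniteMeasure ω := ⟨hmass ▸ ENNReal.ofReal_lt_top⟩
  have : NeZero ω := ⟨Measure.measure_univ_ne_zero.1
    (hmass ▸ (ENNReal.ofReal_pos.2 (betaInt_pos hk hb hw)).ne')⟩
  have hmean : ⨍ t, (1 - t) • x ∂ω = (1 - shrink k b N w) • x := by
    rw [average_withDensity_ofReal (by fun_prop) (ae_restrict_of_forall_mem measurableSet_Ioo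
        fun _ ht => (mul_pos (betaWeight_pos ht)
          (Real.rpow_pos_of_pos (one_add_mul_pos hw (Ioo_subset_Icc_self ht)) _)).le),
      integral_betaWeight_smul_one_sub_smul hk hb hw, smul_smul, ← betaInt, shrink, mul_sub,
      inv_mul_cancel₀ (betaInt_pos hk hb hw).ne', inv_mul_eq_div]
  have hbound : ∀ᵐ t ∂ω, ‖(1 - t) • x‖ ≤ ‖x‖ := by
    refine withDensity_absolutelyContinuous _ _
      (ae_restrict_of_forall_mem measurableSet_Ioo fun t ht => ?_)
    rw [norm_smul, Real.norm_of_nonneg (sub_nonneg.2 ht.2.le)]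
    exact mul_le_of_le_one_left (norm_nonneg x) (by linarith [ht.1])
  have hmem : MemLp (fun t : ℝ => (1 - t) • x) 2 ω :=
    .of_bound (by fun_prop) ‖x‖ hbound
  rw [← hmean]
  convert! isQuadraticAbout_average hmem using 2 with d
  have hdist : Continuous fun t : ℝ => ‖d - (1 - t) • x‖ ^ 2 := by fun_prop
  rw [hω, lintegral_withDensity_eq_lintegral_mul _ (by fun_prop) hdist.measurable.ennreal_ofReal]
  rfl

end BetaMixture

section PosteriorMean

theorem combo_norm_sq_eq {E : Type*} [NormedAddCommGroup E] [InnerProductSpace ℝ E] (θ x : E)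
    {s : ℝ} (hs : s ≠ 0) (t : ℝ) :
    t * ‖θ‖ ^ 2 + (1 - t) * (‖x - θ‖ ^ 2 + s)
      = (1 - t) * (s * (1 + ‖x‖ ^ 2 / s * t)) + ‖θ - (1 - t) • x‖ ^ 2 := by
  have hbase : s * (1 + ‖x‖ ^ 2 / s * t) = s + t * ‖x‖ ^ 2 := by field_simp
  rw [hbase, norm_sub_sq_real, norm_sub_sq_real, inner_smul_right, norm_smul, mul_pow,
    Real.norm_eq_abs, sq_abs, real_inner_comm]
  ring

theorem betaWeight_mul_rpow_eq {k m N D t s v : ℝ} (ht : t ∈ Ioo (0 : ℝ) 1) (hs : 0 < s)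
    (hv : 0 < v) (hN : k + m = N + D) :
    betaWeight k (m - 1) t * ((1 - t) * (s * v)) ^ (D - (k + m))
      = s ^ (-N) * (betaWeight k (D - k - 1) t * v ^ (-N)) := by
  have ht1 : 0 < 1 - t := sub_pos.2 ht.2
  have hexp : D - k - 1 = m - 1 + -N := by linarith
  have hneg : D - (k + m) = -N := by linarith
  rw [hneg, Real.mul_rpow ht1.le (by positivity), Real.mul_rpow hs.le hv.le, betaWeight,
    betaWeight, hexp, Real.rpow_add ht1]
  ring

variable {E : Type*} [NormedAddCommGroup E] [InnerProductSpace ℝ E] [FiniteDimensional ℝ E]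
  [MeasurableSpace E] [BorelSpace E] {μ : Measure E} [μ.IsAddHaarMeasure] {k m N s : ℝ}

theorem lintegral_norm_sub_sq_mul_combo (hs : 0 < s) (hN : k + m = N + (finrank ℝ E : ℝ) / 2)
    (x d : E) {t : ℝ} (ht : t ∈ Ioo (0 : ℝ) 1) :
    ∫⁻ θ, ENNReal.ofReal (‖d - θ‖ ^ 2) * ENNReal.ofReal (betaWeight k (m - 1) t *
        (t * ‖θ‖ ^ 2 + (1 - t) * (‖x - θ‖ ^ 2 + s)) ^ (-(k + m))) ∂μ
      = ENNReal.ofReal (s ^ (-N)) * studentMoment μ 0 (k + m) *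
          (ENNReal.ofReal (betaWeight k ((finrank ℝ E : ℝ) / 2 - k - 1) t *
            (1 + ‖x‖ ^ 2 / s * t) ^ (-N)) * ENNReal.ofReal (‖d - (1 - t) • x‖ ^ 2))
        + ENNReal.ofReal (s ^ (-(N - 1))) * studentMoment μ 2 (k + m) *
          ENNReal.ofReal (betaWeight k ((finrank ℝ E : ℝ) / 2 + 1 - k - 1) t *
            (1 + ‖x‖ ^ 2 / s * t) ^ (-(N - 1))) := by
  have ht1 : 0 < 1 - t := sub_pos.2 ht.2
  have hv : 0 < 1 + ‖x‖ ^ 2 / s * t := by have := ht.1; positivity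
  have hweight := (betaWeight_pos (k := k) (b := m - 1) ht).le
  have hzero := congrArg ENNReal.ofReal (betaWeight_mul_rpow_eq ht hs hv hN)
  have htwo := congrArg ENNReal.ofReal (betaWeight_mul_rpow_eq ht hs hv
    (show k + m = N - 1 + ((finrank ℝ E : ℝ) / 2 + 1) by linarith))
  rw [ENNReal.ofReal_mul hweight, ENNReal.ofReal_mul (by positivity)] at hzero htwo
  simp only [combo_norm_sq_eq _ _ hs.ne', ENNReal.ofReal_mul hweight,
    mul_left_comm (ENNReal.ofReal (‖d - _‖ ^ 2))]
  rw [lintegral_const_mul' _ _ ENNReal.ofReal_ne_top,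
    lintegral_norm_sub_sq_mul_student (by positivity), mul_add, ← mul_assoc (ENNReal.ofReal _)
      (ENNReal.ofReal _) (studentMoment μ 2 _), htwo, mul_left_comm, ← mul_assoc (ENNReal.ofReal _)
      (ENNReal.ofReal _) (studentMoment μ 0 _), hzero]
  ring

theorem lintegral_norm_sub_sq_mul_feynman [Nontrivial E] (hk : 0 < k)
    (hkD : k < (finrank ℝ E : ℝ) / 2) (hm : 0 < m) (hN : k + m = N + (finrank ℝ E : ℝ) / 2)
    (hs : 0 < s) (x d : E) :
    ENNReal.ofReal (betaInt k (m - 1) 0 0) * ∫⁻ θ, ENNReal.ofReal (‖d - θ‖ ^ 2) *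
        ENNReal.ofReal ((‖θ‖ ^ 2) ^ (-k) * (‖x - θ‖ ^ 2 + s) ^ (-m)) ∂μ
      = ENNReal.ofReal (s ^ (-N)) * studentMoment μ 0 (k + m) *
          (∫⁻ t in Ioo (0 : ℝ) 1, ENNReal.ofReal (betaWeight k ((finrank ℝ E : ℝ) / 2 - k - 1) t *
            (1 + ‖x‖ ^ 2 / s * t) ^ (-N)) * ENNReal.ofReal (‖d - (1 - t) • x‖ ^ 2))
        + ENNReal.ofReal (s ^ (-(N - 1))) * studentMoment μ 2 (k + m) *
          ENNReal.ofReal (betaInt k ((finrank ℝ E : ℝ) / 2 + 1 - k - 1) (N - 1) (‖x‖ ^ 2 / s)) := by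
  have hw : -1 < ‖x‖ ^ 2 / s := neg_one_lt_zero.trans_le (by positivity)
  have hfeynman : ∀ᵐ θ ∂μ, ENNReal.ofReal (betaInt k (m - 1) 0 0) *
        (ENNReal.ofReal (‖d - θ‖ ^ 2) *
          ENNReal.ofReal ((‖θ‖ ^ 2) ^ (-k) * (‖x - θ‖ ^ 2 + s) ^ (-m)))
      = ∫⁻ t in Ioo (0 : ℝ) 1, ENNReal.ofReal (‖d - θ‖ ^ 2) * ENNReal.ofReal
          (betaWeight k (m - 1) t *
            (t * ‖θ‖ ^ 2 + (1 - t) * (‖x - θ‖ ^ 2 + s)) ^ (-(k + m))) := by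
    filter_upwards [Measure.ae_ne μ 0] with θ hθ
    rw [lintegral_const_mul' _ _ ENNReal.ofReal_ne_top,
      lintegral_betaWeight_mul_rpow_neg (by positivity) (by positivity),
      lintegral_betaWeight hk (by linarith)]
    ring
  rw [← lintegral_const_mul' _ _ ENNReal.ofReal_ne_top, lintegral_congr_ae hfeynman,
    lintegral_lintegral_swap (by fun_prop), setLIntegral_congr_fun measurableSet_Ioo
      fun t ht => lintegral_norm_sub_sq_mul_combo hs hN x d ht,
    lintegral_add_right _ (by fun_prop), lintegral_const_mul _ (by fun_prop),
    lintegral_const_mul _ (by fun_prop), lintegral_betaWeight_mul_rpow hk (by linarith) hw]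

theorem isQuadraticAbout_lintegral_rpow_mul_rpow [Nontrivial E] (hk : 0 < k)
    (hkD : k < (finrank ℝ E : ℝ) / 2) (hN1 : 1 < N) (hN : k + m = N + (finrank ℝ E : ℝ) / 2)
    (hs : 0 < s) (x : E) :
    IsQuadraticAbout (fun d => ∫⁻ θ, ENNReal.ofReal (‖d - θ‖ ^ 2) *
        ENNReal.ofReal ((‖θ‖ ^ 2) ^ (-k) * (‖x - θ‖ ^ 2 + s) ^ (-m)) ∂μ)
      ((1 - shrink k ((finrank ℝ E : ℝ) / 2 - k - 1) N (‖x‖ ^ 2 / s)) • x) := by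
  have hm : 0 < m := by linarith
  have hw : -1 < ‖x‖ ^ 2 / s := neg_one_lt_zero.trans_le (by positivity)
  set B := ENNReal.ofReal (betaInt k (m - 1) 0 0)
  have hB0 : B ≠ 0 := (ENNReal.ofReal_pos.2 (betaInt_pos hk (by linarith) (by norm_num))).ne'
  have hBtop : B ≠ ∞ := ENNReal.ofReal_ne_top
  have hzero : studentMoment μ 0 (k + m) ≠ ∞ := studentMoment_ne_top (by push_cast; linarith)
  have htwo : studentMoment μ 2 (k + m) ≠ ∞ := studentMoment_ne_top (by push_cast; linarith)
  refine (isQuadraticAbout_betaMixture hk (by linarith) hw x).of_eq_mul_add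
    (c := B⁻¹ * (ENNReal.ofReal (s ^ (-N)) * studentMoment μ 0 (k + m)))
    (K := B⁻¹ * (ENNReal.ofReal (s ^ (-(N - 1))) * studentMoment μ 2 (k + m) *
      ENNReal.ofReal (betaInt k ((finrank ℝ E : ℝ) / 2 + 1 - k - 1) (N - 1) (‖x‖ ^ 2 / s))))
    ?_ ?_ ?_ fun d => ?_
  · exact mul_ne_zero (ENNReal.inv_ne_zero.2 hBtop)
      (mul_ne_zero (ENNReal.ofReal_pos.2 (by positivity)).ne' studentMoment_zero_ne_zero)
  · exact ENNReal.mul_ne_top (ENNReal.inv_ne_top.2 hB0)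
      (ENNReal.mul_ne_top ENNReal.ofReal_ne_top hzero)
  · exact ENNReal.mul_ne_top (ENNReal.inv_ne_top.2 hB0) (ENNReal.mul_ne_top
      (ENNReal.mul_ne_top ENNReal.ofReal_ne_top htwo) ENNReal.ofReal_ne_top)
  · rw [mul_assoc B⁻¹, ← mul_add, ← lintegral_norm_sub_sq_mul_feynman hk hkD hm hN hs x d,
      ENNReal.inv_mul_cancel_left hB0 hBtop]

end PosteriorMean

variable {p n : ℕ}

section Posterior

variable {f : ℝ → ℝ} {π : Euc p → ℝ → ℝ} {y : Euc p × Euc n}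

theorem measurable_mul_posterior (hf : Measurable f) (hπ : Measurable (Function.uncurry π)) :
    Measurable fun q : (Euc p × Euc n) × (Euc p × ℝ) =>
      q.2.2 * posterior f π q.1 q.2.1 q.2.2 := by
  unfold posterior density
  fun_prop

theorem measurable_genBayes (hf : Measurable f) (hπ : Measurable (Function.uncurry π)) :
    Measurable (genBayes f π : Euc p × Euc n → Euc p) := by
  have hpost := measurable_mul_posterior (n := n) hf hπ
  have hsmul : Measurable fun q : (Euc p × Euc n) × (Euc p × ℝ) =>
      (q.2.2 * posterior f π q.1 q.2.1 q.2.2) • q.2.1 := hpost.smul (by fun_prop)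
  exact (hpost.stronglyMeasurable.integral_prod_right'.measurable).inv.smul
    hsmul.stronglyMeasurable.integral_prod_right'.measurable

/-- The (unnormalized) posterior distribution of `(θ, η)` given `y`, weighted by the factor `η` of
the loss. -/
noncomputable def weightedPosterior (f : ℝ → ℝ) (π : Euc p → ℝ → ℝ) (y : Euc p × Euc n) :
    Measure (Euc p × ℝ) :=
  ((volume : Measure (Euc p)).prod (volume.restrict (Ioi 0))).withDensity fun q =>
    ENNReal.ofReal (q.2 * posterior f π y q.1 q.2)

theorem posteriorLoss_eq_lintegral (hf : Measurable f) (hπ : Measurable (Function.uncurry π))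
    (d : Euc p) :
    posteriorLoss f π y d = ∫⁻ q, ENNReal.ofReal (‖d - q.1‖ ^ 2) ∂weightedPosterior f π y := by
  have hpost : Measurable fun q : Euc p × ℝ => q.2 * posterior f π y q.1 q.2 :=
    (measurable_mul_posterior hf hπ).comp measurable_prodMk_left
  rw [weightedPosterior, lintegral_withDensity_eq_lintegral_mul _ hpost.ennreal_ofReal
    (by fun_prop), lintegral_prod _ (hpost.ennreal_ofReal.mul (by fun_prop)).aemeasurable,
    posteriorLoss]
  refine lintegral_congr fun θ => lintegral_congr fun η => ?_
  rw [Pi.mul_apply, ← ENNReal.ofReal_mul' (sq_nonneg _), loss, mul_right_comm]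

theorem genBayes_eq_average (hf : IsErrorDensity p n f) (hπ : Measurable (Function.uncurry π))
    (hπ0 : ∀ θ η, 0 < η → 0 ≤ π θ η) :
    genBayes f π y = ⨍ q, q.1 ∂weightedPosterior f π y := by
  have hpost : Measurable fun q : Euc p × ℝ => q.2 * posterior f π y q.1 q.2 :=
    (measurable_mul_posterior hf.measurable hπ).comp measurable_prodMk_left
  have hpost0 : ∀ᵐ q ∂(volume : Measure (Euc p)).prod (volume.restrict (Ioi 0)),
      0 ≤ q.2 * posterior f π y q.1 q.2 := by
    filter_upwards [Measure.quasiMeasurePreserving_snd.ae (ae_restrict_mem measurableSet_Ioi)]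
      with q (hq : 0 < q.2)
    have hdensity : 0 ≤ f (q.2 * (‖y.1 - q.1‖ ^ 2 + ‖y.2‖ ^ 2)) := hf.nonneg _ (by positivity)
    have hprior := hπ0 q.1 q.2 hq
    unfold posterior density
    positivity
  rw [weightedPosterior, average_withDensity_ofReal hpost hpost0, genBayes]

theorem IsQuadraticAbout.genBayes_eq {v : Euc p} (hf : IsErrorDensity p n f)
    (hπ : Measurable (Function.uncurry π)) (hπ0 : ∀ θ η, 0 < η → 0 ≤ π θ η)
    (h : IsQuadraticAbout (posteriorLoss f π y) v) : genBayes f π y = v := by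
  rw [genBayes_eq_average hf hπ hπ0]
  refine IsQuadraticAbout.average_eq measurable_fst.aestronglyMeasurable ?_
  convert h using 1
  exact funext fun d => (posteriorLoss_eq_lintegral hf.measurable hπ d).symm

end Posterior

section TailMoment

theorem lintegral_Ioi_comp_mul {R : ℝ} (hR : 0 < R) (G : ℝ → ℝ≥0∞) :
    ∫⁻ η in Ioi (0 : ℝ), G (R * η) = ENNReal.ofReal R⁻¹ * ∫⁻ t in Ioi (0 : ℝ), G t := by
  have himage : (fun η : ℝ => R * η) '' Ioi 0 = Ioi 0 := by
    rw [image_mul_left_Ioi hR, mul_zero]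
  have hderiv : ∀ η ∈ Ioi (0 : ℝ), HasDerivWithinAt (fun η => R * η) R (Ioi 0) η := fun η _ => by
    simpa using ((hasDerivAt_id η).const_mul R).hasDerivWithinAt
  conv_rhs => rw [← himage]
  rw [lintegral_image_eq_lintegral_abs_deriv_mul measurableSet_Ioi hderiv
    (mul_right_injective₀ hR.ne').injOn, lintegral_const_mul' _ _ ENNReal.ofReal_ne_top,
    ← mul_assoc, ← ENNReal.ofReal_mul (by positivity), abs_of_pos hR, inv_mul_cancel₀ hR.ne',
    ENNReal.ofReal_one, one_mul]

theorem lintegral_comp_eq_zero_of_homogeneous {E : Type*} [NormedAddCommGroup E] [NormedSpace ℝ E]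
    [FiniteDimensional ℝ E] [MeasurableSpace E] [BorelSpace E] {μ : Measure E}
    [μ.IsAddHaarMeasure] {q : E → ℝ} (hq : Measurable q)
    (hsmul : ∀ (c : ℝ) (y : E), q (c • y) = c ^ 2 * q y) (hpos : ∀ᵐ y ∂μ, 0 < q y) {G : ℝ → ℝ≥0∞}
    (hG : Measurable G) (h : ∫⁻ t in Ioi (0 : ℝ), G t = 0) : ∫⁻ y, G (q y) ∂μ = 0 := by
  have hswap : ∫⁻ η in Ioi (0 : ℝ), ∫⁻ y, G (q y * η) ∂μ = 0 := by
    rw [lintegral_lintegral_swap (by fun_prop)]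
    refine (lintegral_congr_ae ?_).trans lintegral_zero
    filter_upwards [hpos] with y hy
    rw [lintegral_Ioi_comp_mul hy, h, mul_zero]
  rw [lintegral_eq_zero_iff (by fun_prop)] at hswap
  have : NeBot (ae ((volume : Measure ℝ).restrict (Ioi 0))) :=
    ae_restrict_neBot.2 (by rw [Real.volume_Ioi]; exact ENNReal.top_ne_zero)
  obtain ⟨η, hη, hη0⟩ := (hswap.and (ae_restrict_mem measurableSet_Ioi)).exists
  beta_reduce at hη
  have hscale : ∀ y, q (√η • y) = q y * η := fun y => by
    rw [hsmul, Real.sq_sqrt (le_of_lt hη0), mul_comm]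
  rw [← ofReal_pow_finrank_mul_lintegral_comp_smul μ (Real.sqrt_pos.2 hη0) (by fun_prop)]
  simp only [hscale]
  rw [hη, Pi.zero_apply, mul_zero]

/-- The moment `∫₀^∞ t ^ τ f(t) dt`. -/
noncomputable def tailMoment (f : ℝ → ℝ) (τ : ℝ) : ℝ≥0∞ :=
  ∫⁻ t in Ioi (0 : ℝ), ENNReal.ofReal (t ^ τ * f t)

variable {f : ℝ → ℝ} {a e : ℝ}

theorem MomentCondition.tailMoment_ne_top (hM : MomentCondition p n a e f) :
    tailMoment f (((n : ℝ) + p) / 2 - a + e) ≠ ∞ :=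
  hM.lintegral_lt_top.ne

theorem IsErrorDensity.tailMoment_ne_zero (hp : 1 ≤ p) (hf : IsErrorDensity p n f) (τ : ℝ) :
    tailMoment f τ ≠ 0 := fun hzero => by
  have hfm := hf.measurable
  have hvanish : ∫⁻ t in Ioi (0 : ℝ), ENNReal.ofReal (f t) = 0 := by
    rw [tailMoment, lintegral_eq_zero_iff (by fun_prop)] at hzero
    rw [lintegral_eq_zero_iff (by fun_prop)]
    filter_upwards [hzero, ae_restrict_mem measurableSet_Ioi] with t ht (ht0 : 0 < t)
    rw [Pi.zero_apply, ENNReal.ofReal_eq_zero] at ht ⊢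
    exact nonpos_of_mul_nonpos_right ht (by positivity)
  have hpos : ∀ᵐ y : Euc p × Euc n, 0 < ‖y.1‖ ^ 2 + ‖y.2‖ ^ 2 := by
    filter_upwards [Measure.quasiMeasurePreserving_fst.ae (ae_ne_zero_of_one_le hp)] with y hy
    positivity
  have : (volume : Measure (Euc p × Euc n)).IsAddHaarMeasure :=
    inferInstanceAs ((volume : Measure (Euc p)).prod (volume : Measure (Euc n))).IsAddHaarMeasure
  refine one_ne_zero (hf.lintegral_eq_one.symm.trans
    (lintegral_comp_eq_zero_of_homogeneous (by fun_prop) (fun c y => ?_) hpos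
      hfm.ennreal_ofReal hvanish))
  rw [Prod.smul_fst, Prod.smul_snd, norm_smul, norm_smul, mul_pow, mul_pow, Real.norm_eq_abs,
    sq_abs, mul_add]

end TailMoment

section Prior

variable {f : ℝ → ℝ} {a e : ℝ}

theorem measurable_prior : Measurable (Function.uncurry (prior a e : Euc p → ℝ → ℝ)) := by
  unfold prior
  fun_prop

theorem prior_nonneg (θ : Euc p) {η : ℝ} (hη : 0 < η) : 0 ≤ prior a e θ η := by
  unfold prior
  positivity

theorem loss_mul_posterior_prior_eq (x d θ : Euc p) {z : Euc n} (hz : z ≠ 0) {η : ℝ}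
    (hη : 0 < η) :
    loss d θ η * posterior f (prior a e) (x, z) θ η
      = ‖d - θ‖ ^ 2 * ((‖θ‖ ^ 2) ^ (-((p : ℝ) / 2 + a + 1))
          * (‖x - θ‖ ^ 2 + ‖z‖ ^ 2) ^ (-(((n : ℝ) + p) / 2 - a + e)))
        * (((‖x - θ‖ ^ 2 + ‖z‖ ^ 2) * η) ^ (((n : ℝ) + p) / 2 - a + e)
          * f ((‖x - θ‖ ^ 2 + ‖z‖ ^ 2) * η)) := by
  have hnorm : ‖θ‖ ^ (-2 * ((p : ℝ) / 2 + a + 1)) = (‖θ‖ ^ 2) ^ (-((p : ℝ) / 2 + a + 1)) := by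
    rw [← Real.rpow_natCast, ← Real.rpow_mul (norm_nonneg _)]
    push_cast
    ring_nf
  have hη_pow : η * (η ^ (((p : ℝ) + n) / 2) * η ^ (-a - 1 + e))
      = η ^ (((n : ℝ) + p) / 2 - a + e) := by
    rw [← Real.rpow_add hη, mul_comm, ← Real.rpow_add_one hη.ne']
    ring_nf
  have hR : 0 < ‖x - θ‖ ^ 2 + ‖z‖ ^ 2 := by positivity
  have hcancel : ∀ τ : ℝ, (‖x - θ‖ ^ 2 + ‖z‖ ^ 2) ^ (-τ) * ((‖x - θ‖ ^ 2 + ‖z‖ ^ 2) * η) ^ τ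
      = η ^ τ := fun τ => by
    rw [Real.mul_rpow hR.le hη.le, ← mul_assoc, ← Real.rpow_add hR, neg_add_cancel,
      Real.rpow_zero, one_mul]
  rw [loss, posterior, density, prior, hnorm, mul_comm η (_ + _)]
  linear_combination ‖d - θ‖ ^ 2 * (‖θ‖ ^ 2) ^ (-((p : ℝ) / 2 + a + 1))
    * f ((‖x - θ‖ ^ 2 + ‖z‖ ^ 2) * η) * (hη_pow - hcancel (((n : ℝ) + p) / 2 - a + e))

theorem posteriorLoss_prior_eq (x d : Euc p) {z : Euc n} (hz : z ≠ 0) :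
    posteriorLoss f (prior a e) (x, z) d = tailMoment f (((n : ℝ) + p) / 2 - a + e) *
      ∫⁻ θ : Euc p, ENNReal.ofReal (‖d - θ‖ ^ 2) * ENNReal.ofReal
        ((‖θ‖ ^ 2) ^ (-((p : ℝ) / 2 + a + 1)) *
          (‖x - θ‖ ^ 2 + ‖z‖ ^ 2) ^ (-(((n : ℝ) + p) / 2 - a + e + 1))) := by
  rw [posteriorLoss, ← lintegral_const_mul _ (by fun_prop)]
  refine lintegral_congr fun θ => ?_
  have hR : 0 < ‖x - θ‖ ^ 2 + ‖z‖ ^ 2 := by positivity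
  rw [setLIntegral_congr_fun measurableSet_Ioi fun η hη =>
    congrArg ENNReal.ofReal (loss_mul_posterior_prior_eq x d θ hz hη)]
  generalize ((n : ℝ) + p) / 2 - a + e = τ
  simp only [ENNReal.ofReal_mul (show 0 ≤ ‖d - θ‖ ^ 2 * ((‖θ‖ ^ 2) ^ (-((p : ℝ) / 2 + a + 1))
    * (‖x - θ‖ ^ 2 + ‖z‖ ^ 2) ^ (-τ)) by positivity)]
  rw [lintegral_const_mul' _ _ ENNReal.ofReal_ne_top,
    lintegral_Ioi_comp_mul hR fun t => ENNReal.ofReal (t ^ τ * f t), ← tailMoment, ← mul_assoc,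
    mul_comm, ← ENNReal.ofReal_mul (by positivity), ← ENNReal.ofReal_mul (by positivity),
    neg_add τ, Real.rpow_add hR, Real.rpow_neg_one]
  ring_nf

theorem isQuadraticAbout_posteriorLoss (hp : 1 ≤ p) (hf : IsErrorDensity p n f)
    (hM : MomentCondition p n a e f) (ha : -(p : ℝ) / 2 - 1 < a) (ha1 : a < -1)
    (hN1 : 1 < ((p : ℝ) + n) / 2 + e + 2) (x : Euc p) {z : Euc n} (hz : z ≠ 0) :
    IsQuadraticAbout (posteriorLoss f (prior a e) (x, z)) (shrinkEst
      (shrink ((p : ℝ) / 2 + a + 1) (-a - 2) (((p : ℝ) + n) / 2 + e + 2)) (x, z)) := by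
  have : Nonempty (Fin p) := ⟨⟨0, hp⟩⟩
  have hquad := isQuadraticAbout_lintegral_rpow_mul_rpow (μ := (volume : Measure (Euc p)))
    (k := (p : ℝ) / 2 + a + 1) (m := ((n : ℝ) + p) / 2 - a + e + 1) (s := ‖z‖ ^ 2)
    (by linarith) (by rw [finrank_euclideanSpace_fin]; linarith) hN1
    (by rw [finrank_euclideanSpace_fin]; ring) (by positivity) x
  have hexp : (finrank ℝ (Euc p) : ℝ) / 2 - ((p : ℝ) / 2 + a + 1) - 1 = -a - 2 := by
    rw [finrank_euclideanSpace_fin]; ring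
  rw [hexp] at hquad
  exact hquad.of_eq_mul_add (hf.tailMoment_ne_zero hp _) hM.tailMoment_ne_top ENNReal.zero_ne_top
    fun d => by rw [posteriorLoss_prior_eq x d hz, add_zero]

end Prior

section ParameterRange

variable {a e : ℝ}

theorem isGeneralizedBayes_and_isMinimax {f : ℝ → ℝ} (hp : 1 ≤ p) (hn : 1 ≤ n)
    (ha : -(p : ℝ) / 2 - 1 < a) (ha1 : a < -1) (hN1 : 1 < ((p : ℝ) + n) / 2 + e + 2)
    (hr : IsDominatingShrinkage p n
      (shrink ((p : ℝ) / 2 + a + 1) (-a - 2) (((p : ℝ) + n) / 2 + e + 2))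
      (shrinkDeriv ((p : ℝ) / 2 + a + 1) (-a - 2) (((p : ℝ) + n) / 2 + e + 2)))
    (hf : IsErrorDensity p n f) (hM : MomentCondition p n a e f) :
    IsGeneralizedBayes (p := p) (n := n) f (prior a e) (genBayes f (prior a e)) ∧
      IsMinimax (p := p) (n := n) f (genBayes f (prior a e)) := by
  have hquad (x : Euc p) {z : Euc n} (hz : z ≠ 0) :=
    isQuadraticAbout_posteriorLoss hp hf hM ha ha1 hN1 x hz
  have hbayes (x : Euc p) {z : Euc n} (hz : z ≠ 0) :=
    (hquad x hz).genBayes_eq hf measurable_prior fun θ _ => prior_nonneg θ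
  refine ⟨fun x z hz d hd => ?_, hr.isMinimax hp hn hf.measurable
    (measurable_genBayes hf.measurable measurable_prior) fun x z hz => hbayes x hz⟩
  rw [hbayes x hz] at hd ⊢
  exact (hquad x hz).lt hd

theorem cConst_nonneg (hp : 2 ≤ p) : 0 ≤ cConst p n := by
  have hp' : (2 : ℝ) ≤ p := by exact_mod_cast hp
  exact div_nonneg (by linarith) (by positivity)

theorem cConst_mul : cConst p n * ((n : ℝ) + 2) = 2 * ((p : ℝ) - 2) :=
  div_mul_cancel₀ _ (by positivity)

theorem uStar_eq (hp : 2 ≤ p) :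
    uStar p n e = -2 + cConst p n / (1 + cConst p n) * (e + (n : ℝ) / 4 + 3 / 2) := by
  have hc := cConst_nonneg (n := n) hp
  rw [uStar]
  field_simp
  linear_combination 2 * cConst_mul (p := p) (n := n)

theorem uStar_le_neg_two (hp : 2 ≤ p) (he : e ≤ -(n : ℝ) / 4 - 3 / 2) : uStar p n e ≤ -2 := by
  have hc := cConst_nonneg (n := n) hp
  rw [uStar_eq hp, add_le_iff_nonpos_right]
  exact mul_nonpos_of_nonneg_of_nonpos (by positivity) (by linarith)

theorem neg_two_le_uStar (hp : 2 ≤ p) (he : -(n : ℝ) / 4 - 3 / 2 ≤ e) : -2 ≤ uStar p n e := by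
  have hc := cConst_nonneg (n := n) hp
  rw [uStar_eq hp, le_add_iff_nonneg_right]
  exact mul_nonneg (by positivity) (by linarith)

theorem le_uStar_iff (hp : 2 ≤ p) : a ≤ uStar p n e ↔
    ((p : ℝ) / 2 + a + 1) * (n + 2) ≤ 2 * ((p : ℝ) - 2) * ((n : ℝ) / 2 + e - a) := by
  have hc := cConst_nonneg (n := n) hp
  have hscale : 2 * ((p : ℝ) - 2) * ((n : ℝ) / 2 + e - a) - ((p : ℝ) / 2 + a + 1) * (n + 2)
      = ((n : ℝ) + 2) * (cConst p n * ((n : ℝ) / 2 + e) - (p : ℝ) / 2 - 1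
        - a * (1 + cConst p n)) := by
    rw [← cConst_mul (n := n)]; ring
  rw [uStar, le_div_iff₀ (by linarith), ← sub_nonneg,
    ← sub_nonneg (b := ((p : ℝ) / 2 + a + 1) * _), hscale]
  exact (mul_nonneg_iff_of_pos_left (by positivity)).symm

theorem isDominatingShrinkage_of_le_uStar (hp : 2 ≤ p) (ha : -(p : ℝ) / 2 - 1 < a)
    (ha2 : a ≤ -2) (hau : a ≤ uStar p n e) :
    IsDominatingShrinkage p n
      (shrink ((p : ℝ) / 2 + a + 1) (-a - 2) (((p : ℝ) + n) / 2 + e + 2))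
      (shrinkDeriv ((p : ℝ) / 2 + a + 1) (-a - 2) (((p : ℝ) + n) / 2 + e + 2)) := by
  have hk : 0 < (p : ℝ) / 2 + a + 1 := by linarith
  have hbound := (le_uStar_iff hp).1 hau
  have hgap : 0 < (n : ℝ) / 2 + e - a :=
    pos_of_mul_pos_right ((mul_pos hk (by positivity)).trans_le hbound) (by linarith)
  refine isDominatingShrinkage_of_nonneg hk (by linarith) (by linarith) (hbound.trans_eq ?_)
  ring

theorem g_eq (t : ℝ) : g p n e t =
    (2 * p + n - 2) * ((t + 2) * (t + 2 + p)) + 2 * (2 * e + (n : ℝ) / 2 + 3) *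
      ((t + 2) * ((p : ℝ) / 2 + t + 2) - ((p : ℝ) / 2 - 1) * (-t - 1)) := by
  unfold g
  ring

theorem g_eq_sub (ha1 : a < -1) : g p n e a =
    ((p : ℝ) / 2 + a + 1) * (n + 2 + 4 * ((a + 2) * ((p : ℝ) / 2 + a + 2) / (-a - 1)))
      - (2 * (p - 2) - 4 * ((a + 2) * ((p : ℝ) / 2 + a + 2) / (-a - 1)))
        * ((-a - 1) * (((p : ℝ) + n) / 2 + e + 1) - ((p : ℝ) / 2 + a + 1)) := by
  have hne : -a - 1 ≠ 0 := by linarith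
  unfold g
  field_simp
  ring

theorem lt_of_g_nonpos (hp : 3 ≤ p) (he : -(n : ℝ) / 4 - 3 / 2 < e) (ha2 : -2 ≤ a)
    (hg : g p n e a ≤ 0) :
    (a + 2) * ((p : ℝ) / 2 + a + 2) < ((p : ℝ) / 2 - 1) * (-a - 1) := by
  have hp' : (3 : ℝ) ≤ p := by exact_mod_cast hp
  have hn : (0 : ℝ) ≤ n := n.cast_nonneg
  have hT : 0 < 2 * (p : ℝ) + n - 2 := by linarith
  have hE : 0 < 2 * e + (n : ℝ) / 2 + 3 := by linarith
  rcases ha2.eq_or_lt with rfl | ha2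
  · linarith
  rw [g_eq] at hg
  have hs : 0 < a + 2 := by linarith
  have hfirst : 0 < (2 * (p : ℝ) + n - 2) * ((a + 2) * (a + 2 + p)) := by positivity
  have hsecond : 2 * (2 * e + (n : ℝ) / 2 + 3) *
      ((a + 2) * ((p : ℝ) / 2 + a + 2) - ((p : ℝ) / 2 - 1) * (-a - 1)) < 0 := by linarith
  exact sub_neg.1 (neg_of_mul_neg_right hsecond (by positivity))

theorem isDominatingShrinkage_of_g_nonpos (hp : 3 ≤ p) (he : -(n : ℝ) / 4 - 3 / 2 < e)
    (ha2 : -2 ≤ a) (ha1 : a < -1) (hg : g p n e a ≤ 0) :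
    IsDominatingShrinkage p n
      (shrink ((p : ℝ) / 2 + a + 1) (-a - 2) (((p : ℝ) + n) / 2 + e + 2))
      (shrinkDeriv ((p : ℝ) / 2 + a + 1) (-a - 2) (((p : ℝ) + n) / 2 + e + 2)) := by
  have hp' : (3 : ℝ) ≤ p := by exact_mod_cast hp
  have hn : (0 : ℝ) ≤ n := n.cast_nonneg
  have hlt := lt_of_g_nonpos hp he ha2 hg
  rw [← div_lt_iff₀ (by linarith)] at hlt
  have hL : 0 ≤ (a + 2) * ((p : ℝ) / 2 + a + 2) / (-a - 1) :=
    div_nonneg (mul_nonneg (by linarith) (by linarith)) (by linarith)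
  have hk : 0 < (p : ℝ) / 2 + a + 1 := by linarith
  have hb : 1 + (-a - 2) = -a - 1 := by ring
  have hbk : -(-a - 2) * ((p : ℝ) / 2 + a + 1 + 1) = (a + 2) * ((p : ℝ) / 2 + a + 2) := by ring
  have hN : ((p : ℝ) + n) / 2 + e + 2 - 1 = ((p : ℝ) + n) / 2 + e + 1 := by ring
  rw [g_eq_sub ha1, sub_nonpos] at hg
  have hpos := pos_of_mul_pos_right ((mul_pos hk (by positivity)).trans_le hg) (by linarith)
  apply isDominatingShrinkage_of_nonpos hk (by linarith) (by linarith) (by linarith)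
  · rwa [hb, hN]
  · rwa [hb, hbk, hN]

theorem exists_roots_quadratic {A B C u v : ℝ} (hA : 0 < A) (huv : u < v)
    (hu : A * u ^ 2 + B * u + C < 0) (hv : 0 < A * v ^ 2 + B * v + C) :
    ∃ r s : ℝ, r < u ∧ u < s ∧ s < v ∧
      ∀ t, A * t ^ 2 + B * t + C = A * (t - r) * (t - s) := by
  have hcont : ContinuousOn (fun t : ℝ => A * t ^ 2 + B * t + C) (Icc u v) := by fun_prop
  obtain ⟨s, ⟨hus, hsv⟩, hs⟩ := intermediate_value_Ioo huv.le hcont ⟨hu, hv⟩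
  beta_reduce at hs
  have hfactor : ∀ t, A * t ^ 2 + B * t + C = A * (t - (-B / A - s)) * (t - s) := fun t => by
    field_simp
    linear_combination hs
  rw [hfactor u] at hu
  have hr : 0 < A * (u - (-B / A - s)) := pos_of_mul_neg_left hu (by linarith)
  exact ⟨-B / A - s, s, sub_pos.1 (pos_of_mul_pos_right hr hA.le), hus, hsv, hfactor⟩

theorem g_eq_quadratic (t : ℝ) : g p n e t = (2 * p + 2 * n + 4 * e + 4) * t ^ 2
    + (2 * (p : ℝ) ^ 2 + 2 * p * n + 12 * p + 7 * n + 4 * (p + 3) * e + 10) * t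
    + (4 * (p : ℝ) ^ 2 + 7 / 2 * p * n + 6 * (p + 2) * e + 7 * n + 13 * p + 10) := by
  rw [g, mul_comm t]

theorem exists_roots_g (hp : 3 ≤ p) (he : -(n : ℝ) / 4 - 3 / 2 < e) :
    ∃ A r s : ℝ, 0 < A ∧ r < -2 ∧ -2 < s ∧ s < -1 ∧
      ∀ t, g p n e t = A * (t - r) * (t - s) := by
  have hp' : (3 : ℝ) ≤ p := by exact_mod_cast hp
  have hE : 0 < 2 * e + (n : ℝ) / 2 + 3 := by linarith
  have hT : 0 < 2 * (p : ℝ) + n - 2 := by linarith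
  have hA : 0 < 2 * (p : ℝ) + 2 * n + 4 * e + 4 := by linarith
  have hg_neg : g p n e (-2) < 0 := by
    rw [g_eq, neg_add_cancel, zero_mul, zero_mul, mul_zero, zero_add]
    exact mul_neg_of_pos_of_neg (by positivity) (by linarith)
  have hg_pos : 0 < g p n e (-1) := by
    rw [g_eq, neg_neg, sub_self, mul_zero, sub_zero, show (-1 : ℝ) + 2 = 1 by norm_num]
    have hhalf : (p : ℝ) / 2 + -1 + 2 = p / 2 + 1 := by ring
    rw [hhalf]
    positivity
  obtain ⟨r, s, hr, hs2, hs1, hfactor⟩ := exists_roots_quadratic hA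
    (show (-2 : ℝ) < -1 by norm_num) (g_eq_quadratic _ ▸ hg_neg) (g_eq_quadratic _ ▸ hg_pos)
  exact ⟨_, r, s, hA, hr, hs2, hs1, fun t => (g_eq_quadratic t).trans (hfactor t)⟩

theorem isDominatingShrinkage_of_g_root (hp : 3 ≤ p) (he : -(n : ℝ) / 4 - 3 / 2 < e) {A r s : ℝ}
    (hA : 0 < A) (hr : r < -2) (hs1 : s < -1) (hfactor : ∀ t, g p n e t = A * (t - r) * (t - s))
    (ha : -(p : ℝ) / 2 - 1 < a) (has : a ≤ s) :
    IsDominatingShrinkage p n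
      (shrink ((p : ℝ) / 2 + a + 1) (-a - 2) (((p : ℝ) + n) / 2 + e + 2))
      (shrinkDeriv ((p : ℝ) / 2 + a + 1) (-a - 2) (((p : ℝ) + n) / 2 + e + 2)) := by
  rcases le_total a (-2) with ha2 | ha2
  · exact isDominatingShrinkage_of_le_uStar (by omega) ha ha2
      (ha2.trans (neg_two_le_uStar (by omega) he.le))
  · refine isDominatingShrinkage_of_g_nonpos hp he ha2 (has.trans_lt hs1) ?_
    rw [hfactor]
    exact mul_nonpos_of_nonneg_of_nonpos (mul_nonneg hA.le (by linarith)) (by linarith)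

end ParameterRange

end SphericalModel

open SphericalModel in
theorem mainTheorem4_general (p n : ℕ) (hp : 3 ≤ p) (hn : 1 ≤ n) (e : ℝ) :
    ((-(p : ℝ) / 2 - (n : ℝ) / 2 - 1 < e ∧ e ≤ -(n : ℝ) / 4 - 3 / 2) →
      ∀ a : ℝ, -(p : ℝ) / 2 - 1 < a → a ≤ uStar p n e →
        ∀ f : ℝ → ℝ, IsErrorDensity p n f → MomentCondition p n a e f →
          IsGeneralizedBayes (p := p) (n := n) f (prior a e) (genBayes f (prior a e)) ∧
            IsMinimax (p := p) (n := n) f (genBayes f (prior a e)))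
    ∧
    (-(n : ℝ) / 4 - 3 / 2 < e →
      ∃ r aStar : ℝ, r < aStar ∧ {t : ℝ | g p n e t = 0} = {r, aStar} ∧
        -2 < aStar ∧ aStar < -1 ∧
        ∀ a : ℝ, -(p : ℝ) / 2 - 1 < a → a ≤ aStar →
          ∀ f : ℝ → ℝ, IsErrorDensity p n f → MomentCondition p n a e f →
            IsGeneralizedBayes (p := p) (n := n) f (prior a e) (genBayes f (prior a e)) ∧
              IsMinimax (p := p) (n := n) f (genBayes f (prior a e))) := by
  have hp' : (3 : ℝ) ≤ p := by exact_mod_cast hp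
  constructor
  · rintro ⟨he, he'⟩ a ha hau f
    have ha2 : a ≤ -2 := hau.trans (uStar_le_neg_two (by omega) he')
    exact isGeneralizedBayes_and_isMinimax (by omega) hn ha (by linarith) (by linarith)
      (isDominatingShrinkage_of_le_uStar (by omega) ha ha2 hau)
  · intro he
    obtain ⟨A, r, s, hA, hr, hs2, hs1, hfactor⟩ := exists_roots_g hp he
    refine ⟨r, s, hr.trans hs2, ?_, hs2, hs1, fun a ha has f => ?_⟩
    · ext t
      simp [hfactor, hA.ne', sub_eq_zero]
    · exact isGeneralizedBayes_and_isMinimax (by omega) hn ha (by linarith)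
        (by linarith [n.cast_nonneg (α := ℝ)]) (isDominatingShrinkage_of_g_root hp he hA hr hs1
          hfactor ha has)

theorem mainTheorem4 (p n : ℕ) (hp : 3 ≤ p) (hn : 1 ≤ n) (e : ℝ) :
    ((-(p : ℝ) / 2 - (n : ℝ) / 2 - 1 < e ∧ e ≤ -(n : ℝ) / 4 - 3 / 2) →
      ∀ a : ℝ, -(p : ℝ) / 2 - 1 < a → a ≤ SphericalModel.uStar p n e →
        ∀ f : ℝ → ℝ, SphericalModel.IsErrorDensity p n f →
          SphericalModel.MomentCondition p n a e f →
            SphericalModel.IsGeneralizedBayes (p := p) (n := n) f (SphericalModel.prior a e)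
                (SphericalModel.genBayes f (SphericalModel.prior a e)) ∧
              SphericalModel.IsMinimax (p := p) (n := n) f
                (SphericalModel.genBayes f (SphericalModel.prior a e)))
    ∧
    ((-(n : ℝ) / 4 - 3 / 2 < e ∧ 2 ≤ n) →
      ∃ r aStar : ℝ, r < aStar ∧ {t : ℝ | SphericalModel.g p n e t = 0} = {r, aStar} ∧
        -2 < aStar ∧ aStar < -1 ∧
        ∀ a : ℝ, -(p : ℝ) / 2 - 1 < a → a ≤ aStar →
          ∀ f : ℝ → ℝ, SphericalModel.IsErrorDensity p n f →
            SphericalModel.MomentCondition p n a e f →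
              SphericalModel.IsGeneralizedBayes (p := p) (n := n) f (SphericalModel.prior a e)
                  (SphericalModel.genBayes f (SphericalModel.prior a e)) ∧
                SphericalModel.IsMinimax (p := p) (n := n) f
                  (SphericalModel.genBayes f (SphericalModel.prior a e))) :=
  (mainTheorem4_general p n hp hn e).imp_right fun h he => h he.1
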